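/- Let $f,g\in\mathbb{Z}[t_1,t_2]$ be binary quadratic forms with non-zero discriminant. Let $u=(u_1:u_2)$ and $v=(v_1:v_2)$ be the homogeneous coordinates on the two factors of $\mathbb{P}^1\times\mathbb{P}^1$ over $\mathbb{Q}$, and let $\pi:X\to\mathbb{P}^1\times\mathbb{P}^1$ be the conic bundle $$X:\quad f(u_1,u_2)\,x^2+g(v_1,v_2)\,y^2=z^2 ,$$ that is, over the chart $u_i\neq 0,\ v_j\neq 0$ it is the conic $f(u/u_i)x^2+g(v/v_j)y^2=z^2$ in $\mathbb{P}^2$ over that chart, and the conics over the charts $(i,j)$ and $(i',j')$ are glued on the overlap by $(x:y:z)\mapsto(\tfrac{u_{i'}}{u_i}x:\tfrac{v_{j'}}{v_j}y:z)$. For a codimension one point $D$ of $\mathbb{P}^1\times\mathbb{P}^1$ with residue field $\kappa(D)$, let $\Gamma_D$ be the image of $\mathrm{Gal}(\overline{\kappa(D)}/\kappa(D))$ in the group of permutations of the irreducible components of the geometric fibre $\pi^{-1}(D)\otimes\overline{\kappa(D)}$, let $\Gamma_D^\circ\subseteq\Gamma_D$ be the set of those elements that fix some irreducible component of multiplicity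 one, and set $$\delta_D=\frac{\#\Gamma_D^\circ}{\#\Gamma_D},\qquad \Delta(\pi)=\sum_{D}(1-\delta_D),$$ the sum being over all codimension one points $D$ of $\mathbb{P}^1\times\mathbb{P}^1$. Then every group $\Gamma_D$ is finite, $\delta_D\neq 1$ for only finitely many $D$, and $$\Delta(\pi)=\begin{cases}2 & \text{if both } f \text{ and } g \text{ split over } \mathbb{Q},\\ \tfrac32 & \text{if exactly one of } f \text{ and } g \text{ splits over } \mathbb{Q},\\ 1 & \text{if neither } f \text{ nor } g \text{ splits over } \mathbb{Q},\end{cases}$$ where a form splits over $\mathbb{Q}$ if it is a product of two linear forms with coefficients in $\mathbb{Q}$. -/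

import Mathlib

noncomputable section

open AlgebraicGeometry CategoryTheory Limits MvPolynomial

/-! ### Diagonal conics over an affine base

For a commutative ring `B` and `a₀, a₁, a₂ ∈ B` this is the closed subscheme
`a₀ x₀² + a₁ x₁² + a₂ x₂² = 0` of `ℙ²` over `Spec B`, as the `Proj` of its homogeneous
coordinate ring, with the maps between such schemes that are induced by a ring homomorphism and a
diagonal change of coordinates. -/

namespace DiagonalConic

attribute [local instance] MvPolynomial.gradedAlgebra

variable {B : Type} [CommRing B] (a : Fin 3 → B)

/-- The ternary quadratic form `a₀ x₀² + a₁ x₁² + a₂ x₂²`. -/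
def poly : MvPolynomial (Fin 3) B := ∑ i, C (a i) * X i ^ 2

/-- The homogeneous coordinate ring `B[x₀, x₁, x₂] / (a₀ x₀² + a₁ x₁² + a₂ x₂²)`. -/
abbrev CoordRing : Type := MvPolynomial (Fin 3) B ⧸ Ideal.span {poly a}

/-- The quotient map onto the homogeneous coordinate ring. -/
abbrev mk : MvPolynomial (Fin 3) B →ₐ[B] CoordRing a := Ideal.Quotient.mkₐ B _

/-- The grading of the coordinate ring by degree. -/
def grading (n : ℕ) : Submodule B (CoordRing a) :=
  (homogeneousSubmodule (Fin 3) B n).map (mk a).toLinearMap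

/-- The class of the coordinate `xᵢ`. -/
def coord (i : Fin 3) : CoordRing a := mk a (X i)

lemma mk_mem {p : MvPolynomial (Fin 3) B} {n : ℕ} (hp : p.IsHomogeneous n) :
    mk a p ∈ grading a n := ⟨p, hp, rfl⟩

lemma coord_mem (i : Fin 3) : coord a i ∈ grading a 1 := mk_mem a (isHomogeneous_X _ _)

lemma isHomogeneous_poly : (poly a).IsHomogeneous 2 :=
  IsHomogeneous.sum _ _ _ fun i _ ↦ by
    simpa using (isHomogeneous_C (Fin 3) (a i)).mul ((isHomogeneous_X B i).pow 2)

instance : SetLike.GradedMonoid (grading a) where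
  one_mem := ⟨1, isHomogeneous_one _ _, map_one (mk a)⟩
  mul_mem := by
    rintro m n _ _ ⟨p, hp, rfl⟩ ⟨q, hq, rfl⟩
    exact ⟨p * q, IsHomogeneous.mul hp hq, map_mul (mk a) _ _⟩

/-- The quotient map in degree `n`. -/
def component (n : ℕ) : homogeneousSubmodule (Fin 3) B n →+ grading a n where
  toFun p := ⟨mk a p.1, mk_mem a p.2⟩
  map_zero' := by ext; simp
  map_add' p q := by ext; simp

/-- The decomposition into homogeneous components, on the polynomial ring. -/
def decomposeAux : MvPolynomial (Fin 3) B →+ DirectSum ℕ fun n ↦ grading a n :=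
  (DirectSum.map (component a)).comp
    (DirectSum.decomposeAddEquiv (homogeneousSubmodule (Fin 3) B)).toAddMonoidHom

lemma decomposeAux_eq_zero (p : MvPolynomial (Fin 3) B) (hp : p ∈ Ideal.span {poly a}) :
    decomposeAux a p = 0 := by
  have hI : (Ideal.span {poly a}).IsHomogeneous (homogeneousSubmodule (Fin 3) B) :=
    Ideal.homogeneous_span _ _ (by rintro _ rfl; exact ⟨2, isHomogeneous_poly a⟩)
  ext n
  simp only [decomposeAux, AddMonoidHom.comp_apply, DirectSum.map_apply, component]
  exact Ideal.Quotient.eq_zero_iff_mem.mpr (hI n hp)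

/-- The decomposition into homogeneous components. -/
def decomposeHom : CoordRing a →+ DirectSum ℕ fun n ↦ grading a n :=
  QuotientAddGroup.lift (Ideal.span {poly a}).toAddSubgroup (decomposeAux a)
    (decomposeAux_eq_zero a)

lemma decomposeHom_mk (p : MvPolynomial (Fin 3) B) :
    decomposeHom a (mk a p) = DirectSum.map (component a)
      (DirectSum.decompose (homogeneousSubmodule (Fin 3) B) p) := rfl

instance : DirectSum.Decomposition (grading a) where
  decompose' := decomposeHom a
  left_inv p := by
    obtain ⟨p, rfl⟩ := Ideal.Quotient.mkₐ_surjective B _ p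
    rw [decomposeHom_mk]
    have h : (DirectSum.coeAddMonoidHom (grading a)).comp (DirectSum.map (component a)) =
        ((mk a).toRingHom.toAddMonoidHom).comp
          (DirectSum.coeAddMonoidHom (homogeneousSubmodule (Fin 3) B)) := by
      ext n x
      simp [component]
    refine (DFunLike.congr_fun h (DirectSum.decompose (homogeneousSubmodule (Fin 3) B) p)).trans ?_
    exact congrArg (mk a) (DirectSum.Decomposition.left_inv (ℳ := homogeneousSubmodule (Fin 3) B) p)
  right_inv p := by
    induction p using DirectSum.induction_on with
    | zero => simp
    | add p q hp hq => simp only [map_add, hp, hq]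
    | of n p =>
      obtain ⟨_, p, hp, rfl⟩ := p
      rw [DirectSum.coeAddMonoidHom_of]
      change decomposeHom a (mk a p) = _
      rw [decomposeHom_mk, DirectSum.decompose_of_mem (homogeneousSubmodule (Fin 3) B) hp,
        DirectSum.map_of]
      rfl

instance : GradedAlgebra (grading a) where

lemma irrelevant_le :
    (HomogeneousIdeal.irrelevant (grading a)).toIdeal ≤ Ideal.span (Set.range (coord a)) := by
  rw [HomogeneousIdeal.toIdeal_irrelevant_le]
  rintro n hn _ ⟨p, hp, rfl⟩
  change mk a p ∈ _
  have hp' : p ∈ Ideal.span (Set.range (X : Fin 3 → MvPolynomial (Fin 3) B)) := by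
    rw [← Set.image_univ, mem_ideal_span_X_image]
    intro m hm
    have := hp.degree_eq_sum_deg_support  hm
    by_contra! h
    have : m = 0 := by ext i; simpa using h i
    subst this
    simp_all
  have := Ideal.mem_map_of_mem (mk a) hp'
  rwa [Ideal.map_span, ← Set.range_comp] at this

/-- The conic `a₀ x₀² + a₁ x₁² + a₂ x₂² = 0` in `ℙ²` over `Spec B`. -/
abbrev scheme : Scheme.{0} := Proj (grading a)

/-- The structure morphism of the conic to `Spec B`. -/
def toSpec : scheme a ⟶ Spec (.of B) :=
  Proj.toSpecZero (grading a) ≫ Spec.map (CommRingCat.ofHom (algebraMap B (grading a 0)))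

section map
variable {B' : Type} [CommRing B'] (φ : B →+* B') (s : Fin 3 → B')
  {a} {a' : Fin 3 → B'} (h : ∀ i, φ (a i) * s i ^ 2 = a' i)

/-- The ring homomorphism of coordinate rings over `φ : B → B'` with `xᵢ ↦ sᵢ xᵢ`, available
when `φ(aᵢ) sᵢ² = a'ᵢ`. -/
def ringHom : CoordRing a →+* CoordRing a' :=
  Ideal.Quotient.lift _ ((mk a').toRingHom.comp
      (eval₂Hom (C.comp φ) fun i ↦ C (s i) * X i)) (by
    suffices Ideal.span {poly a} ≤ RingHom.ker ((mk a').toRingHom.comp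
      (eval₂Hom (C.comp φ) fun i ↦ C (s i) * X i)) from fun p hp ↦ this hp
    rw [Ideal.span_singleton_le_iff_mem, RingHom.mem_ker, RingHom.comp_apply]
    have : eval₂Hom (C.comp φ) (fun i ↦ C (s i) * X i) (poly a) = poly a' := by
      simp only [poly, map_sum, map_mul, map_pow, ← h]
      refine Finset.sum_congr rfl fun i _ ↦ ?_
      simp
      ring
    rw [this]
    exact Ideal.Quotient.eq_zero_iff_mem.mpr (Ideal.mem_span_singleton_self _))

lemma ringHom_mk (p : MvPolynomial (Fin 3) B) :
    ringHom φ s h (mk a p) = mk a' (eval₂Hom (C.comp φ) (fun i ↦ C (s i) * X i) p) := rfl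

@[simp] lemma ringHom_coord (i : Fin 3) :
    ringHom φ s h (coord a i) = algebraMap B' _ (s i) * coord a' i := by
  rw [coord, ringHom_mk, coe_eval₂Hom, eval₂_X, map_mul]
  rfl

@[simp] lemma ringHom_algebraMap (b : B) :
    ringHom φ s h (algebraMap B _ b) = algebraMap B' _ (φ b) := by
  change ringHom φ s h (mk a (C b)) = _
  rw [ringHom_mk, coe_eval₂Hom, eval₂_C]
  rfl

lemma ringHom_ext {R : Type*} [CommRing R] {f g : CoordRing a →+* R}
    (h₀ : ∀ b, f (algebraMap B _ b) = g (algebraMap B _ b))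
    (h₁ : ∀ i, f (coord a i) = g (coord a i)) : f = g := by
  apply Ideal.Quotient.ringHom_ext
  exact MvPolynomial.ringHom_ext h₀ h₁

/-- `ringHom` as a homomorphism of graded rings. -/
def gradedHom : grading a →+*ᵍ grading a' where
  __ := ringHom φ s h
  map_mem {n} := by
    rintro _ ⟨p, hp, rfl⟩
    refine mk_mem a' ?_
    have := hp.eval₂ (C.comp φ) (fun i ↦ C (s i) * X i) (n := 1)
      (fun r ↦ isHomogeneous_C _ _) (fun i ↦ by
        simpa using (isHomogeneous_C (Fin 3) (s i)).mul (isHomogeneous_X B' i))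
    simpa using this

lemma irrelevant_le_map (hs : ∀ i, IsUnit (s i)) :
    HomogeneousIdeal.irrelevant (grading a') ≤
      (HomogeneousIdeal.irrelevant (grading a)).map (gradedHom φ s h) := by
  refine (irrelevant_le a').trans ?_
  rw [Ideal.span_le]
  rintro _ ⟨i, rfl⟩
  obtain ⟨t, ht⟩ := (hs i).exists_left_inv
  have : coord a' i = algebraMap B' _ t * gradedHom φ s h (coord a i) := by
    change _ = _ * ringHom φ s h (coord a i)
    rw [ringHom_coord, ← mul_assoc, ← map_mul, ht, map_one, one_mul]
  rw [this]
  exact Ideal.mul_mem_left _ _ (Ideal.mem_map_of_mem _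
    (HomogeneousIdeal.mem_irrelevant_of_mem _ one_pos (coord_mem a i)))

/-- The morphism of conics over `Spec B' ⟶ Spec B` given by `xᵢ ↦ sᵢ xᵢ` with units `sᵢ`. -/
def map (hs : ∀ i, IsUnit (s i)) : scheme a' ⟶ scheme a :=
  Proj.map (gradedHom φ s h) (irrelevant_le_map φ s h hs)

lemma map_eq_of_eq {s' : Fin 3 → B'} {φ' : B →+* B'}
    {h' : ∀ i, φ' (a i) * s' i ^ 2 = a' i} (hs hs') (e : s = s') (e' : φ = φ') :
    map φ s h hs = map φ' s' h' hs' := by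
  subst e e'; rfl

/-- The structure map to a standard chart ring. -/
def toAway (y : CoordRing a) : B →+* HomogeneousLocalization.Away (grading a) y :=
  (HomogeneousLocalization.fromZeroRingHom (grading a) _).comp (algebraMap B (grading a 0))

lemma val_toAway (y : CoordRing a) (b : B) :
    (toAway y b).val = algebraMap (CoordRing a) (Localization.Away y) (algebraMap B _ b) := by
  simp only [toAway, RingHom.comp_apply, HomogeneousLocalization.fromZeroRingHom]
  change HomogeneousLocalization.val (HomogeneousLocalization.mk _) = _
  rw [HomogeneousLocalization.val_mk]
  exact Localization.mk_one_eq_algebraMap _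

lemma away_map_toAway (y : CoordRing a) :
    (HomogeneousLocalization.Away.map (gradedHom φ s h) y).comp (toAway y) =
      (toAway (gradedHom φ s h y)).comp φ := by
  ext b : 1
  apply HomogeneousLocalization.val_injective
  simp only [RingHom.comp_apply, val_toAway]
  simp only [toAway, RingHom.comp_apply, HomogeneousLocalization.fromZeroRingHom]
  change HomogeneousLocalization.val (HomogeneousLocalization.mk _) = _
  rw [HomogeneousLocalization.val_mk]
  refine Eq.trans ?_ (Localization.mk_one_eq_algebraMap _)
  rw [← ringHom_algebraMap φ s h]
  congr 1
  ext
  simp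

lemma awayι_toSpec (y : CoordRing a) {n : ℕ} (hy : y ∈ grading a n) (hn : 0 < n) :
    Proj.awayι (grading a) y hy hn ≫ toSpec a = Spec.map (CommRingCat.ofHom (toAway y)) := by
  rw [toSpec, Proj.awayι_toSpecZero_assoc, ← Spec.map_comp]
  rfl

lemma awayι_toSpec_assoc (y : CoordRing a) {n : ℕ} (hy : y ∈ grading a n) (hn : 0 < n)
    {T : Scheme.{0}} (t : Spec (.of B) ⟶ T) :
    Proj.awayι (grading a) y hy hn ≫ toSpec a ≫ t = Spec.map (CommRingCat.ofHom (toAway y)) ≫ t := by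
  rw [← Category.assoc, awayι_toSpec]

lemma coord_span_le (hs : ∀ i, IsUnit (s i)) : (HomogeneousIdeal.irrelevant (grading a')).toIdeal ≤
    Ideal.span (Set.range fun i ↦ gradedHom φ s h (coord a i)) := by
  refine (irrelevant_le a').trans ?_
  rw [Ideal.span_le]
  rintro _ ⟨i, rfl⟩
  obtain ⟨t, ht⟩ := (hs i).exists_left_inv
  have : coord a' i = algebraMap B' _ t * gradedHom φ s h (coord a i) := by
    change _ = _ * ringHom φ s h (coord a i)
    rw [ringHom_coord, ← mul_assoc, ← map_mul, ht, map_one, one_mul]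
  rw [this]
  exact Ideal.mul_mem_left _ _ (Ideal.subset_span ⟨i, rfl⟩)

/-- The cover of the conic by the affine charts on which some `sᵢ xᵢ` does not vanish. -/
def imageCover (hs : ∀ i, IsUnit (s i)) : (scheme a').AffineOpenCover :=
  Proj.affineOpenCoverOfIrrelevantLESpan (grading a') (fun i ↦ gradedHom φ s h (coord a i))
    (m := fun _ ↦ 1) (fun i ↦ (gradedHom φ s h).2 (coord_mem a i)) (fun _ ↦ one_pos)
    (coord_span_le φ s h hs)

lemma map_toSpec (hs : ∀ i, IsUnit (s i)) :
    map φ s h hs ≫ toSpec a = toSpec a' ≫ Spec.map (CommRingCat.ofHom φ) := by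
  refine (imageCover φ s h hs).openCover.hom_ext _ _ fun i ↦ ?_
  change Proj.awayι (grading a') (gradedHom φ s h (coord a i)) _ _ ≫ Proj.map _ _ ≫ _ =
    Proj.awayι (grading a') (gradedHom φ s h (coord a i)) _ _ ≫ _
  rw [Proj.awayι_comp_map_assoc _ _ one_pos _ (coord_mem a i), awayι_toSpec,
    awayι_toSpec_assoc, ← Spec.map_comp, ← Spec.map_comp, ← CommRingCat.ofHom_comp,
    ← CommRingCat.ofHom_comp, away_map_toAway]

/-- The homomorphism `B[x₀, x₁, x₂] → B[x₀/y, x₁/y, x₂/y]`, `xᵢ ↦ xᵢ / y`. -/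
def ratioHom (a : Fin 3 → B) {y : CoordRing a} (hy : y ∈ grading a 1) :
    MvPolynomial (Fin 3) B →+* HomogeneousLocalization.Away (grading a) y :=
  eval₂Hom (toAway y) fun i ↦ .mk _ hy 1 (coord a i) (by simpa using coord_mem a i)

lemma val_ratioHom {y : CoordRing a} (hy : y ∈ grading a 1) {n : ℕ} {p : MvPolynomial (Fin 3) B}
    (hp : p.IsHomogeneous n) : algebraMap _ (Localization.Away y) (y ^ n) * (ratioHom a hy p).val =
      algebraMap (CoordRing a) (Localization.Away y) (mk a p) := by
  let ι := algebraMap (CoordRing a) (Localization.Away y)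
  have h₁ : (ratioHom a hy p).val = eval₂Hom (ι.comp (algebraMap B _))
      (fun i ↦ Localization.mk (coord a i) ⟨y ^ 1, 1, rfl⟩) p := by
    rw [← HomogeneousLocalization.algebraMap_apply, ← RingHom.comp_apply]
    refine DFunLike.congr_fun (MvPolynomial.ringHom_ext (fun b ↦ ?_) fun i ↦ ?_) p
    · simp [ratioHom, val_toAway, ι]
    · simp [ratioHom]
  have h₂ : ι (mk a p) = eval₂Hom (ι.comp (algebraMap B _)) (fun i ↦ ι (coord a i)) p := by
    change (ι.comp (mk a).toRingHom) p = _
    refine DFunLike.congr_fun (MvPolynomial.ringHom_ext (fun b ↦ ?_) fun i ↦ ?_) p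
    · simp only [RingHom.comp_apply, coe_eval₂Hom, eval₂_C]
      rfl
    · simp [coord]
  change ι (y ^ n) * _ = ι (mk a p)
  rw [h₁, h₂, coe_eval₂Hom, coe_eval₂Hom, eval₂_eq', eval₂_eq', Finset.mul_sum]
  refine Finset.sum_congr rfl fun m hm ↦ ?_
  have hn : n = ∑ i, m i := by
    rw [hp.degree_eq_sum_deg_support hm]
    exact Finset.sum_subset (Finset.subset_univ _) fun i _ hi ↦ by simpa using hi
  have e (i : Fin 3) : ι (coord a i) = ι y * Localization.mk (coord a i)
      (⟨y ^ 1, (⟨1, rfl⟩ : y ^ 1 ∈ Submonoid.powers y)⟩ : Submonoid.powers y) := by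
    simp only [ι, ← Localization.mk_one_eq_algebraMap, Localization.mk_mul,
      Localization.mk_eq_mk_iff, Localization.r_iff_exists]
    exact ⟨1, by simp [mul_comm]⟩
  simp only [e, mul_pow, Finset.prod_mul_distrib]
  rw [map_pow, hn, ← Finset.prod_pow_eq_pow_sum]
  ring

lemma ratioHom_surjective {y : CoordRing a} (hy : y ∈ grading a 1) :
    Function.Surjective (ratioHom a hy) := by
  intro z
  obtain ⟨n, _, ⟨p, hp, rfl⟩, rfl⟩ := HomogeneousLocalization.Away.mk_surjective _ hy z
  refine ⟨p, HomogeneousLocalization.val_injective _ ?_⟩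
  refine Eq.trans ?_ (HomogeneousLocalization.Away.val_mk _ _ hy _ _).symm
  rw [Localization.mk_eq_mk']
  symm
  rw [IsLocalization.mk'_eq_iff_eq_mul, mul_comm]
  exact (val_ratioHom hy (by simpa using hp)).symm

lemma away_hom_ext {y : CoordRing a} (hy : y ∈ grading a 1) {R : Type*} [CommRing R]
    {f g : HomogeneousLocalization.Away (grading a) y →+* R}
    (h₀ : ∀ b, f (toAway y b) = g (toAway y b))
    (h₁ : ∀ i, f (ratioHom a hy (X i)) = g (ratioHom a hy (X i))) : f = g := by
  rw [← RingHom.cancel_right (ratioHom_surjective hy)]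
  refine MvPolynomial.ringHom_ext (fun b ↦ ?_) h₁
  simpa [ratioHom] using h₀ b

lemma isPushout (hs : ∀ i, IsUnit (s i)) (k : Fin 3) : IsPushout
    (CommRingCat.ofHom (toAway (coord a k))) (CommRingCat.ofHom φ)
    (CommRingCat.ofHom (HomogeneousLocalization.Away.map (gradedHom φ s h) (coord a k)))
    (CommRingCat.ofHom (toAway (gradedHom φ s h (coord a k)))) := by
  have hy' : gradedHom φ s h (coord a k) ∈ grading a' 1 := (gradedHom φ s h).2 (coord_mem a k)
  choose t ht using fun i ↦ (hs i).exists_left_inv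
  have hratio (i : Fin 3) : ratioHom a' hy' (X i) = toAway _ (t i) *
      HomogeneousLocalization.Away.map (gradedHom φ s h) (coord a k)
        (ratioHom a (coord_mem a k) (X i)) := by
    have e : coord a' i = algebraMap B' _ (t i) * gradedHom φ s h (coord a i) := by
      change _ = _ * ringHom φ s h (coord a i)
      rw [ringHom_coord, ← mul_assoc, ← map_mul, ht, map_one, one_mul]
    apply HomogeneousLocalization.val_injective
    rw [HomogeneousLocalization.val_mul, val_toAway]
    simp only [ratioHom, coe_eval₂Hom, eval₂_X, HomogeneousLocalization.Away.map_mk,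
      HomogeneousLocalization.Away.val_mk]
    rw [e, ← Localization.mk_one_eq_algebraMap, Localization.mk_mul, one_mul]
  have hkk : ratioHom a (coord_mem a k) (X k) = 1 := by
    apply HomogeneousLocalization.val_injective
    simp only [ratioHom, coe_eval₂Hom, eval₂_X, HomogeneousLocalization.Away.val_mk,
      HomogeneousLocalization.val_one]
    rw [← Localization.mk_one, Localization.mk_eq_mk_iff, Localization.r_iff_exists]
    exact ⟨1, by simp⟩
  have hrel : ∑ i, toAway (coord a k) (a i) * ratioHom a (coord_mem a k) (X i) ^ 2 = 0 := by
    have h₁ : ∑ i, toAway (coord a k) (a i) * ratioHom a (coord_mem a k) (X i) ^ 2 =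
        ratioHom a (coord_mem a k) (poly a) := by
      simp only [poly, map_sum, map_mul, map_pow]
      simp only [ratioHom, coe_eval₂Hom, eval₂_C]
    have h₂ := val_ratioHom (coord_mem a k) (isHomogeneous_poly a)
    have h₃ : mk a (poly a) = 0 :=
      Ideal.Quotient.eq_zero_iff_mem.mpr (Ideal.mem_span_singleton_self _)
    rw [h₃, map_zero] at h₂
    rw [h₁]
    apply HomogeneousLocalization.val_injective
    rw [HomogeneousLocalization.val_zero]
    have hu := (IsLocalization.Away.algebraMap_isUnit
      (S := Localization.Away (coord a k)) (coord a k)).pow 2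
    rw [← map_pow] at hu
    exact (hu.mul_right_eq_zero).mp h₂
  have key : ∀ (T : CommRingCat.{0}) (f : HomogeneousLocalization.Away (grading a) (coord a k) →+* T)
      (g : B' →+* T), f.comp (toAway (coord a k)) = g.comp φ →
      ∃ d : HomogeneousLocalization.Away (grading a') (gradedHom φ s h (coord a k)) →+* T,
        d.comp (HomogeneousLocalization.Away.map (gradedHom φ s h) (coord a k)) = f ∧
        d.comp (toAway (gradedHom φ s h (coord a k))) = g := by
    intro T f g hfg
    have hfg' (b : B) : f (toAway (coord a k) b) = g (φ b) := DFunLike.congr_fun hfg b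
    have hgt (i : Fin 3) : g (t i) * g (s i) = 1 := by rw [← map_mul, ht, map_one]
    let e₀ : MvPolynomial (Fin 3) B' →+* T :=
      eval₂Hom g fun i ↦ g (t i) * f (ratioHom a (coord_mem a k) (X i))
    let e : CoordRing a' →+* T := Ideal.Quotient.lift _ e₀ (by
      suffices Ideal.span {poly a'} ≤ RingHom.ker e₀ from fun p hp ↦ this hp
      rw [Ideal.span_singleton_le_iff_mem, RingHom.mem_ker]
      refine Eq.trans ?_ ((congrArg f hrel).trans (map_zero f))
      simp only [e₀, poly, map_sum, map_mul, map_pow, ← h]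
      refine Finset.sum_congr rfl fun i _ ↦ ?_
      simp only [coe_eval₂Hom, eval₂_C, eval₂_X, hfg']
      linear_combination (g (φ (a i)) * f (ratioHom a (coord_mem a k) (X i)) ^ 2 *
        (g (t i) * g (s i) + 1)) * hgt i)
    have e_alg (b : B') : e (algebraMap B' _ b) = g b := by
      change e₀ (C b) = _
      simp [e₀]
    have e_coord (i : Fin 3) : e (coord a' i) = g (t i) * f (ratioHom a (coord_mem a k) (X i)) := by
      change e₀ (X i) = _
      simp [e₀]
    have e_y : e (gradedHom φ s h (coord a k)) = 1 := by
      change e (ringHom φ s h (coord a k)) = 1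
      rw [ringHom_coord, map_mul, e_alg, e_coord, hkk, map_one, mul_one, mul_comm, hgt]
    let d : HomogeneousLocalization.Away (grading a') (gradedHom φ s h (coord a k)) →+* T :=
      (IsLocalization.Away.lift (S := Localization.Away (gradedHom φ s h (coord a k)))
        (gradedHom φ s h (coord a k)) (g := e) (by rw [e_y]; exact isUnit_one)).comp
      (algebraMap _ (Localization.Away (gradedHom φ s h (coord a k))))
    have d_alg (b : B') : d (toAway _ b) = g b := by
      simp only [d, RingHom.comp_apply, HomogeneousLocalization.algebraMap_apply, val_toAway]
      rw [IsLocalization.Away.lift_eq, e_alg]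
    have d_ratio (i : Fin 3) : d (ratioHom a' hy' (X i)) = e (coord a' i) := by
      have h₁ := congrArg (IsLocalization.Away.lift
        (S := Localization.Away (gradedHom φ s h (coord a k)))
        (gradedHom φ s h (coord a k)) (g := e) (by rw [e_y]; exact isUnit_one))
        (val_ratioHom hy' (isHomogeneous_X B' i))
      rw [map_mul, IsLocalization.Away.lift_eq, IsLocalization.Away.lift_eq, pow_one] at h₁
      exact ((one_mul _).symm.trans (congrArg (· * _) e_y.symm)).trans h₁
    clear_value d
    refine ⟨d, away_hom_ext (coord_mem a k) (fun b ↦ ?_) (fun i ↦ ?_), RingHom.ext d_alg⟩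
    · have := DFunLike.congr_fun (away_map_toAway φ s h (coord a k)) b
      exact (congrArg d this).trans ((d_alg _).trans (hfg' b).symm)
    · have h₁ := d_ratio i
      rw [hratio, map_mul, d_alg, e_coord] at h₁
      rw [RingHom.comp_apply]
      linear_combination g (s i) * h₁ + (f (ratioHom a (coord_mem a k) (X i)) -
        d (HomogeneousLocalization.Away.map (gradedHom φ s h) (coord a k)
          (ratioHom a (coord_mem a k) (X i)))) * hgt i
  have uniq : ∀ (T : CommRingCat.{0})
      (d d' : HomogeneousLocalization.Away (grading a') (gradedHom φ s h (coord a k)) →+* T),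
        d.comp (HomogeneousLocalization.Away.map (gradedHom φ s h) (coord a k)) =
          d'.comp (HomogeneousLocalization.Away.map (gradedHom φ s h) (coord a k)) →
        d.comp (toAway (gradedHom φ s h (coord a k))) =
          d'.comp (toAway (gradedHom φ s h (coord a k))) → d = d' := by
    intro T d d' h₁ h₂
    refine away_hom_ext hy' (DFunLike.congr_fun h₂) fun i ↦ ?_
    rw [hratio, map_mul, map_mul]
    exact congr_arg₂ _ (DFunLike.congr_fun h₂ _) (DFunLike.congr_fun h₁ _)
  have w : CommRingCat.ofHom (toAway (coord a k)) ≫ CommRingCat.ofHom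
      (HomogeneousLocalization.Away.map (gradedHom φ s h) (coord a k)) =
      CommRingCat.ofHom φ ≫ CommRingCat.ofHom (toAway (gradedHom φ s h (coord a k))) := by
    rw [← CommRingCat.ofHom_comp, ← CommRingCat.ofHom_comp, away_map_toAway]
  choose d hd₁ hd₂ using key
  have hc (c : PushoutCocone (CommRingCat.ofHom (toAway (coord a k))) (CommRingCat.ofHom φ)) :
      c.inl.hom.comp (toAway (coord a k)) = c.inr.hom.comp φ := by
    simpa using congrArg CommRingCat.Hom.hom c.condition
  refine ⟨⟨w⟩, ⟨PushoutCocone.IsColimit.mk w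
    (fun c ↦ CommRingCat.ofHom (d c.pt c.inl.hom c.inr.hom (hc c))) (fun c ↦ ?_) (fun c ↦ ?_)
    fun c m h₁ h₂ ↦ ?_⟩⟩
  · ext1; exact hd₁ _ _ _ _
  · ext1; exact hd₂ _ _ _ _
  · ext1
    refine uniq _ _ _ ?_ ?_
    · rw [CommRingCat.hom_ofHom, hd₁, ← h₁]; rfl
    · rw [CommRingCat.hom_ofHom, hd₂, ← h₂]; rfl

/-- The conic over `B'` is the base change of the conic over `B`. -/
lemma isPullback (hs : ∀ i, IsUnit (s i)) : IsPullback (map φ s h hs) (toSpec a') (toSpec a)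
    (Spec.map (CommRingCat.ofHom φ)) := by
  refine Scheme.isPullback_of_openCover _ _ _ _
    (Proj.affineOpenCoverOfIrrelevantLESpan (grading a) (coord a)
      (m := fun _ ↦ 1) (coord_mem a) (fun _ ↦ one_pos) (irrelevant_le a)).openCover fun k ↦ ?_
  have h₁ := IsOpenImmersion.isPullback
    (Spec.map (CommRingCat.ofHom (HomogeneousLocalization.Away.map (gradedHom φ s h) (coord a k))))
    (Proj.awayι (grading a') (gradedHom φ s h (coord a k))
      ((gradedHom φ s h).2 (coord_mem a k)) one_pos)
    (Proj.awayι (grading a) (coord a k) (coord_mem a k) one_pos) (map φ s h hs)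
    (Proj.awayι_comp_map _ _ one_pos _ (coord_mem a k)) (by
      rw [Proj.opensRange_awayι, Proj.opensRange_awayι]
      exact Proj.map_preimage_basicOpen _ _ _)
  have h₂ := isPullback_SpecMap_of_isPushout _ _ _ _ (isPushout φ s h hs k)
  rw [← awayι_toSpec _ (coord_mem a k) one_pos,
    ← awayι_toSpec _ ((gradedHom φ s h).2 (coord_mem a k)) one_pos] at h₂
  refine h₂.of_iso h₁.flip.isoPullback (Iso.refl _) (Iso.refl _) (Iso.refl _) ?_ ?_ ?_ ?_
  · exact (Category.comp_id _).trans h₁.flip.isoPullback_hom_snd.symm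
  · exact (Category.comp_id _).trans
      ((congrArg (· ≫ toSpec a') h₁.flip.isoPullback_hom_fst.symm).trans (Category.assoc _ _ _))
  · exact (Category.comp_id _).trans (Category.id_comp _).symm
  · exact (Category.comp_id _).trans (Category.id_comp _).symm

end map

lemma map_id (h) (hs) : map (RingHom.id B) (fun _ ↦ 1) h hs = 𝟙 (scheme a) := by
  have : gradedHom (RingHom.id B) (fun _ ↦ 1) h = .id (grading a) := by
    ext x
    refine DFunLike.congr_fun (f := ringHom (RingHom.id B) (fun _ ↦ 1) h)
      (g := RingHom.id _) (ringHom_ext ?_ ?_) x <;> simp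
  refine Eq.trans ?_ (Proj.map_id (𝒜 := grading a))
  unfold map
  congr 1

lemma map_comp {B' B'' : Type} [CommRing B'] [CommRing B''] {a' : Fin 3 → B'} {a'' : Fin 3 → B''}
    {a : Fin 3 → B}
    {φ : B →+* B'} {φ' : B' →+* B''} {s s'} {h : ∀ i, φ (a i) * s i ^ 2 = a' i}
    {h' : ∀ i, φ' (a' i) * s' i ^ 2 = a'' i}
    (hs hs' h'' hs'') :
    map φ' s' h' hs' ≫ map φ s h hs =
      map (φ'.comp φ) (fun i ↦ φ' (s i) * s' i) h'' hs'' := by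
  have : gradedHom (φ'.comp φ) (fun i ↦ φ' (s i) * s' i) h'' =
      (gradedHom φ' s' h').comp (gradedHom φ s h) := by
    ext x
    refine DFunLike.congr_fun (f := ringHom (φ'.comp φ) (fun i ↦ φ' (s i) * s' i) h'')
      (g := (ringHom φ' s' h').comp (ringHom φ s h)) (ringHom_ext ?_ ?_) x <;> simp [mul_assoc]
  refine (Proj.map_comp _ _ _ _).symm.trans ?_
  unfold map
  congr 1
  exact this.symm

end DiagonalConic

section Base

attribute [local instance] MvPolynomial.gradedAlgebra

/-! ### The base `ℙ¹ × ℙ¹` -/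

/-- The projective line over `ℚ`. -/
abbrev P1 : Scheme.{0} := Proj (homogeneousSubmodule (Fin 2) ℚ)

/-- The structure morphism of the projective line. -/
def P1.toSpec : P1 ⟶ Spec (.of ℚ) :=
  Proj.toSpecZero (homogeneousSubmodule (Fin 2) ℚ) ≫
    Spec.map (CommRingCat.ofHom (algebraMap ℚ (homogeneousSubmodule (Fin 2) ℚ 0)))

namespace P1

/-- The locus where the `i`-th homogeneous coordinate does not vanish. -/
def nonvanishing (i : Fin 2) : P1.Opens := Proj.basicOpen (homogeneousSubmodule (Fin 2) ℚ) (X i)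

/-- The function `X j / X i` on the locus where `X i` does not vanish. -/
def ratio (i j : Fin 2) : Γ(P1, nonvanishing i) :=
  Proj.awayToSection (homogeneousSubmodule (Fin 2) ℚ) (X i)
    (HomogeneousLocalization.Away.mk (homogeneousSubmodule (Fin 2) ℚ) (isHomogeneous_X ℚ i) 1 (X j)
      (isHomogeneous_X ℚ j))

lemma iSup_nonvanishing : ⨆ i, nonvanishing i = ⊤ := by
  apply Proj.iSup_basicOpen_eq_top
  rw [HomogeneousIdeal.toIdeal_irrelevant_le]
  intro n hn p hp
  change p ∈ Ideal.span _
  rw [← Set.image_univ, mem_ideal_span_X_image]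
  intro m hm
  have := IsHomogeneous.degree_eq_sum_deg_support hp hm
  by_contra! h
  have : m = 0 := by ext i; simpa using h i
  subst this
  simp_all

lemma ratio_self (i : Fin 2) : ratio i i = 1 := by
  refine Eq.trans (congrArg (Proj.awayToSection (homogeneousSubmodule (Fin 2) ℚ) (X i)).hom ?_)
    (map_one (Proj.awayToSection (homogeneousSubmodule (Fin 2) ℚ) (X i)).hom)
  apply HomogeneousLocalization.val_injective
  change Localization.mk (X i) ⟨X i ^ 1, _⟩ = _
  rw [HomogeneousLocalization.val_one, ← Localization.mk_one, Localization.mk_eq_mk_iff, Localization.r_iff_exists]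
  exact ⟨1, by simp⟩

lemma ratio_mul_ratio (i j k : Fin 2) :
    P1.presheaf.map (homOfLE inf_le_left : nonvanishing i ⊓ nonvanishing j ⟶ nonvanishing i).op (ratio i j) *
      P1.presheaf.map (homOfLE inf_le_right : nonvanishing i ⊓ nonvanishing j ⟶ nonvanishing j).op (ratio j k) =
    P1.presheaf.map (homOfLE inf_le_left : nonvanishing i ⊓ nonvanishing j ⟶ nonvanishing i).op (ratio i k) := by
  apply Subtype.ext
  funext p
  apply HomogeneousLocalization.val_injective
  refine (HomogeneousLocalization.val_mul _ _).trans ?_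
  change Localization.mk (X j) ⟨X i ^ 1, _⟩ * Localization.mk (X k) ⟨X j ^ 1, _⟩ =
    Localization.mk (X k) ⟨X i ^ 1, _⟩
  rw [Localization.mk_mul, Localization.mk_eq_mk_iff, Localization.r_iff_exists]
  exact ⟨1, by simp; ring⟩

variable {S : Scheme.{0}} (p : S ⟶ P1)

/-- The pullback of the function `X j / X i` along `p`, on an open set `U` on which the pullback of
`X i` does not vanish. -/
def ratioOn (U : S.Opens) (i : Fin 2) (hU : U ≤ p ⁻¹ᵁ nonvanishing i) (j : Fin 2) : Γ(S, U) :=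
  p.appLE (nonvanishing i) U hU (ratio i j)

lemma ratioOn_self (U : S.Opens) (i : Fin 2) (hU : U ≤ p ⁻¹ᵁ nonvanishing i) : ratioOn p U i hU i = 1 := by
  rw [ratioOn, ratio_self, map_one]

lemma ratioOn_mul_ratioOn (U : S.Opens) (i j : Fin 2) (hi : U ≤ p ⁻¹ᵁ nonvanishing i) (hj : U ≤ p ⁻¹ᵁ nonvanishing j)
    (k : Fin 2) : ratioOn p U i hi j * ratioOn p U j hj k = ratioOn p U i hi k := by
  have h := congrArg (p.appLE (nonvanishing i ⊓ nonvanishing j) U (le_inf hi hj)) (ratio_mul_ratio i j k)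
  have e {V : P1.Opens} (hV : nonvanishing i ⊓ nonvanishing j ≤ V) (x : Γ(P1, V)) :
      p.appLE (nonvanishing i ⊓ nonvanishing j) U (le_inf hi hj) (P1.presheaf.map (homOfLE hV).op x) =
        p.appLE V U ((le_inf hi hj : U ≤ p ⁻¹ᵁ (nonvanishing i ⊓ nonvanishing j)).trans (p.preimage_mono hV)) x := by
    exact congrArg (fun φ ↦ φ.hom x)
      (Scheme.Hom.map_appLE p (U := nonvanishing i ⊓ nonvanishing j) (le_inf hi hj) (homOfLE hV).op)
  rw [map_mul, e, e, e] at h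
  exact h

lemma map_ratioOn {U V : S.Opens} (h : U ≤ V) (i : Fin 2) (hV : V ≤ p ⁻¹ᵁ nonvanishing i) (j : Fin 2) :
    S.presheaf.map (homOfLE h).op (ratioOn p V i hV j) = ratioOn p U i (h.trans hV) j := by
  simp only [ratioOn, ← CommRingCat.comp_apply, Scheme.Hom.appLE_map]

lemma isUnit_ratioOn (U : S.Opens) (i j : Fin 2) (hi : U ≤ p ⁻¹ᵁ nonvanishing i) (hj : U ≤ p ⁻¹ᵁ nonvanishing j) :
    IsUnit (ratioOn p U i hi j) :=
  .of_mul_eq_one (ratioOn p U j hj i) (by rw [ratioOn_mul_ratioOn, ratioOn_self])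

end P1

/-- The surface `P¹ × P¹` over `ℚ`. -/
def P1xP1 : Scheme.{0} := pullback P1.toSpec P1.toSpec

namespace P1xP1

/-- The first projection. -/
def fst : P1xP1 ⟶ P1 := pullback.fst _ _
/-- The second projection. -/
def snd : P1xP1 ⟶ P1 := pullback.snd _ _

/-- For `c = (i, j)` the affine chart `uᵢ ≠ 0`, `vⱼ ≠ 0` of `ℙ¹ × ℙ¹`, where `u₀, u₁` and `v₀, v₁` are
the homogeneous coordinates of the two factors. -/
def chart (c : Fin 2 × Fin 2) : P1xP1.Opens := fst ⁻¹ᵁ P1.nonvanishing c.1 ⊓ snd ⁻¹ᵁ P1.nonvanishing c.2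

end P1xP1

/-! ### Binary quadratic forms -/

/-- The binary quadratic form `a x² + b x y + c y²` with integer coefficients. -/
structure BinaryQuadraticForm where
  a : ℤ
  b : ℤ
  c : ℤ

namespace BinaryQuadraticForm
variable (f : BinaryQuadraticForm)

/-- The value of the form at a point of a commutative ring. -/
def eval {R : Type*} [CommRing R] (x y : R) : R := f.a * x ^ 2 + f.b * (x * y) + f.c * y ^ 2

/-- The discriminant `b² - 4 a c`. -/
def disc : ℤ := f.b ^ 2 - 4 * f.a * f.c

/-- The form splits over `ℚ`: it is a product of two linear forms with rational coefficients. -/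
def SplitsOverRat : Prop :=
  ∃ α β γ δ : ℚ, (f.eval (X 0) (X 1) : MvPolynomial (Fin 2) ℚ) =
    (C α * X 0 + C β * X 1) * (C γ * X 0 + C δ * X 1)

lemma eval_mul {R : Type*} [CommRing R] (x y t : R) :
    f.eval (x * t) (y * t) = f.eval x y * t ^ 2 := by
  simp only [eval]; ring

lemma map_eval {R S : Type*} [CommRing R] [CommRing S] (φ : R →+* S) (x y : R) :
    φ (f.eval x y) = f.eval (φ x) (φ y) := by
  simp [eval]

end BinaryQuadraticForm

/-! ### The conic bundle `f(u) x² + g(v) y² = z²`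

The form `f(u) x² + g(v) y² - z²` is homogeneous of bidegree `(2, 0)`, `(0, 2)`, `(0, 0)` in its three
coefficients, so `x`, `y`, `z` are sections of line bundles: the total space is a conic in the
projectivisation of a rank three bundle over `ℙ¹ × ℙ¹`. It is described on affine open sets.
On an affine open `U` inside the chart `uᵢ ≠ 0`, `vⱼ ≠ 0` it is the conic
`f(u/uᵢ) x² + g(v/vⱼ) y² = z²` in `ℙ²` over `U`, and the conics for `(i, j)` and `(i', j')` are
identified by `(x, y, z) ↦ (u_{i'}/u_i x, v_{j'}/v_j y, z)`. -/

/-- An affine open subset `U` of `ℙ¹ × ℙ¹` together with a chart `c` that contains it. -/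
structure Patch where
  U : P1xP1.Opens
  isAffine : IsAffineOpen U
  c : Fin 2 × Fin 2
  le : U ≤ P1xP1.chart c

namespace Patch

instance : Preorder Patch := Preorder.lift U

lemma le_fst (P : Patch) : P.U ≤ P1xP1.fst ⁻¹ᵁ P1.nonvanishing P.c.1 := P.le.trans inf_le_left
lemma le_snd (P : Patch) : P.U ≤ P1xP1.snd ⁻¹ᵁ P1.nonvanishing P.c.2 := P.le.trans inf_le_right

/-- Restriction of functions. -/
def res {P Q : Patch} (h : P ≤ Q) : Γ(P1xP1, Q.U) →+* Γ(P1xP1, P.U) :=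
  (P1xP1.presheaf.map (homOfLE (show P.U ≤ Q.U from h)).op).hom

/-- The functions `u₀/uᵢ, u₁/uᵢ` on a patch in the chart `(i, j)`. -/
def u (P : Patch) : Fin 2 → Γ(P1xP1, P.U) := P1.ratioOn P1xP1.fst P.U P.c.1 P.le_fst
/-- The functions `v₀/vⱼ, v₁/vⱼ` on a patch in the chart `(i, j)`. -/
def v (P : Patch) : Fin 2 → Γ(P1xP1, P.U) := P1.ratioOn P1xP1.snd P.U P.c.2 P.le_snd

variable (f g : BinaryQuadraticForm)

/-- The coefficients `f(u/uᵢ)`, `g(v/vⱼ)`, `-1` of the conic over a patch in the chart `(i, j)`. -/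
def coeffs (P : Patch) : Fin 3 → Γ(P1xP1, P.U) :=
  ![f.eval (P.u 0) (P.u 1), g.eval (P.v 0) (P.v 1), -1]

/-- The change of coordinates `u_{i'}/u_i`, `v_{j'}/v_j`, `1` from a patch in the chart `(i, j)` to a patch
in the chart `(i', j')` containing it. -/
def scale {P Q : Patch} (_ : P ≤ Q) : Fin 3 → Γ(P1xP1, P.U) :=
  ![P.u Q.c.1, P.v Q.c.2, 1]

lemma u_eq {P Q : Patch} (h : P ≤ Q) (i : Fin 2) : P.u i = res h (Q.u i) * P.u Q.c.1 := by
  rw [mul_comm]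
  refine (P1.ratioOn_mul_ratioOn _ P.U P.c.1 Q.c.1 P.le_fst ((show P.U ≤ Q.U from h).trans Q.le_fst) i).symm.trans ?_
  rw [← P1.map_ratioOn _ (show P.U ≤ Q.U from h) _ Q.le_fst]
  rfl

lemma v_eq {P Q : Patch} (h : P ≤ Q) (i : Fin 2) : P.v i = res h (Q.v i) * P.v Q.c.2 := by
  rw [mul_comm]
  refine (P1.ratioOn_mul_ratioOn _ P.U P.c.2 Q.c.2 P.le_snd ((show P.U ≤ Q.U from h).trans Q.le_snd) i).symm.trans ?_
  rw [← P1.map_ratioOn _ (show P.U ≤ Q.U from h) _ Q.le_snd]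
  rfl

lemma res_coeffs {P Q : Patch} (h : P ≤ Q) (i : Fin 3) :
    res h (coeffs f g Q i) * scale h i ^ 2 = coeffs f g P i := by
  fin_cases i
  · change res h (f.eval (Q.u 0) (Q.u 1)) * P.u Q.c.1 ^ 2 = f.eval (P.u 0) (P.u 1)
    rw [u_eq h 0, u_eq h 1, BinaryQuadraticForm.eval_mul, BinaryQuadraticForm.map_eval]
  · change res h (g.eval (Q.v 0) (Q.v 1)) * P.v Q.c.2 ^ 2 = g.eval (P.v 0) (P.v 1)
    rw [v_eq h 0, v_eq h 1, BinaryQuadraticForm.eval_mul, BinaryQuadraticForm.map_eval]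
  · change res h (-1) * 1 ^ 2 = -1
    simp

lemma isUnit_scale {P Q : Patch} (h : P ≤ Q) (i : Fin 3) : IsUnit (scale h i) := by
  fin_cases i
  · exact P1.isUnit_ratioOn _ _ _ _ P.le_fst ((show P.U ≤ Q.U from h).trans Q.le_fst)
  · exact P1.isUnit_ratioOn _ _ _ _ P.le_snd ((show P.U ≤ Q.U from h).trans Q.le_snd)
  · exact isUnit_one

lemma exists_mem (x : P1xP1) : ∃ c, x ∈ P1xP1.chart c := by
  have h (y : P1) : ∃ i, y ∈ P1.nonvanishing i := by
    have : y ∈ ⨆ i, P1.nonvanishing i := by rw [P1.iSup_nonvanishing]; trivial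
    simpa using this
  obtain ⟨i, hi⟩ := h (P1xP1.fst x)
  obtain ⟨j, hj⟩ := h (P1xP1.snd x)
  exact ⟨(i, j), hi, hj⟩

lemma exists_le {x : P1xP1} {V : P1xP1.Opens} (hx : x ∈ V) : ∃ P : Patch, x ∈ P.U ∧ P.U ≤ V := by
  obtain ⟨c, hc⟩ := exists_mem x
  obtain ⟨U, hU, hxU, hle⟩ := TopologicalSpace.Opens.isBasis_iff_nbhd.mp
    P1xP1.isBasis_affineOpens (show x ∈ V ⊓ P1xP1.chart c from ⟨hx, hc⟩)
  exact ⟨⟨U, hU, c, hle.trans inf_le_right⟩, hxU, hle.trans inf_le_left⟩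

/-- The patches form an open cover of `ℙ¹ × ℙ¹`, and a basis of its topology. -/
def cover : P1xP1.OpenCover where
  I₀ := Patch
  X P := P.U
  f P := P.U.ι
  mem₀ := by
    rw [Scheme.presieve₀_mem_precoverage_iff]
    refine ⟨fun x ↦ ?_, inferInstance⟩
    obtain ⟨P, hP, -⟩ := exists_le (show x ∈ (⊤ : P1xP1.Opens) from trivial)
    exact ⟨P, by simpa using hP⟩

instance : Preorder cover.I₀ := inferInstanceAs <| Preorder Patch

instance : cover.LocallyDirected :=
  .ofIsBasisOpensRange (fun {P Q} ↦ by
    change P.U ≤ Q.U ↔ P.U.ι.opensRange ≤ Q.U.ι.opensRange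
    simp) <| by
    rw [TopologicalSpace.Opens.isBasis_iff_nbhd]
    intro V x hx
    obtain ⟨P, hP, hle⟩ := exists_le hx
    refine ⟨P.U.ι.opensRange, ⟨P, rfl⟩, ?_, ?_⟩ <;> simpa

lemma res_id (P : Patch) (h : P ≤ P) : res h = RingHom.id _ := by
  ext x
  exact congrArg (fun φ ↦ φ.hom x) (P1xP1.presheaf.map_id _)

lemma res_comp {P Q R : Patch} (h : P ≤ Q) (h' : Q ≤ R) :
    (res h).comp (res h') = res (h.trans h') := by
  ext x
  exact congrArg (fun φ ↦ φ.hom x) (P1xP1.presheaf.map_comp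
    (homOfLE (show Q.U ≤ R.U from h')).op (homOfLE (show P.U ≤ Q.U from h)).op).symm

lemma scale_id (P : Patch) (h : P ≤ P) : scale h = fun _ ↦ 1 := by
  ext i
  fin_cases i
  · exact P1.ratioOn_self ..
  · exact P1.ratioOn_self ..
  · rfl

lemma scale_comp {P Q R : Patch} (h : P ≤ Q) (h' : Q ≤ R) :
    (fun i ↦ res h (scale h' i) * scale h i) = scale (h.trans h') := by
  ext i
  fin_cases i
  · exact (u_eq h _).symm
  · exact (v_eq h _).symm
  · change res h 1 * 1 = 1
    simp

/-- The conics over the patches, with the transition maps. -/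
def functor : Patch ⥤ Scheme.{0} where
  obj P := DiagonalConic.scheme (coeffs f g P)
  map {P Q} h := DiagonalConic.map (res h.le) (scale h.le) (res_coeffs f g h.le) (isUnit_scale h.le)
  map_id P :=
    (DiagonalConic.map_eq_of_eq _ _ _ _ (fun _ ↦ isUnit_one) (scale_id P le_rfl)
      (res_id P le_rfl)).trans (DiagonalConic.map_id _ (fun i ↦ by rw [RingHom.id_apply, one_pow, mul_one]) _)
  map_comp {P Q R} h h' :=
    (DiagonalConic.map_eq_of_eq _ _ _ _
      (fun i ↦ ((isUnit_scale h'.le i).map (res h.le)).mul (isUnit_scale h.le i))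
      (scale_comp h.le h'.le).symm (res_comp h.le h'.le).symm).trans
    (DiagonalConic.map_comp (isUnit_scale h'.le) (isUnit_scale h.le) (fun i ↦ by
      rw [res_comp, congrFun (scale_comp h.le h'.le) i]; exact res_coeffs ..) _).symm

/-- The projection of the conic over a patch to the patch. -/
def structureMap (P : Patch) : DiagonalConic.scheme (coeffs f g P) ⟶ P.U :=
  DiagonalConic.toSpec (coeffs f g P) ≫ P.isAffine.isoSpec.inv

lemma isoSpec_inv_homOfLE {P Q : Patch} (h : P ≤ Q) :
    P.isAffine.isoSpec.inv ≫ P1xP1.homOfLE (show P.U ≤ Q.U from h) =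
      Spec.map (CommRingCat.ofHom (res h)) ≫ Q.isAffine.isoSpec.inv := by
  rw [← cancel_mono Q.U.ι, Category.assoc, Category.assoc, Scheme.homOfLE_ι,
    IsAffineOpen.isoSpec_inv_ι, IsAffineOpen.isoSpec_inv_ι]
  exact (Q.isAffine.map_fromSpec P.isAffine (homOfLE (show P.U ≤ Q.U from h)).op).symm

lemma isPullback {P Q : Patch} (h : P ≤ Q) : IsPullback
    (DiagonalConic.map (res h) (scale h) (res_coeffs f g h) (isUnit_scale h))
    (structureMap f g P) (structureMap f g Q) (P1xP1.homOfLE (show P.U ≤ Q.U from h)) :=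
  (DiagonalConic.isPullback (res h) (scale h) (res_coeffs f g h) (isUnit_scale h)).paste_vert
    (.of_vert_isIso ⟨(isoSpec_inv_homOfLE h).symm⟩)

lemma cover_trans {P Q : Patch} (h : P ⟶ Q) :
    cover.trans h = P1xP1.homOfLE (show P.U ≤ Q.U from h.le) := rfl

/-- The projections are compatible with the transition maps. -/
def natTrans : functor f g ⟶ cover.functorOfLocallyDirected :=
  NatTrans.mk (fun P ↦ show DiagonalConic.scheme (coeffs f g P) ⟶ P.U from structureMap f g P)
    fun _ _ h ↦ (isPullback f g h.le).w

/-- The conics over the patches as a gluing datum over `ℙ¹ × ℙ¹`. -/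
def gluingData : cover.RelativeGluingData where
  functor := functor f g
  natTrans := natTrans f g
  equifibered _ _ h := isPullback f g h.le

end Patch


instance : Quiver.IsThin Patch.cover.I₀ := inferInstanceAs (Quiver.IsThin Patch)

/-- The total space `f(u) x² + g(v) y² = z²` of the conic bundle. -/
def conicBundle (f g : BinaryQuadraticForm) : Scheme.{0} := (Patch.gluingData f g).glued

/-- The conic bundle morphism `π` to `ℙ¹ × ℙ¹`. -/
def conicBundle.π (f g : BinaryQuadraticForm) : conicBundle f g ⟶ P1xP1 := (Patch.gluingData f g).toBase

end Base

/-! ### The invariant `Δ` of a morphism of schemes -/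

namespace Fibration

universe u

lemma image_mem_irreducibleComponents {X : Scheme.{u}} (e : Aut X) {C : Set X}
    (hC : C ∈ irreducibleComponents X) : e.hom '' C ∈ irreducibleComponents X := by
  have h : (Scheme.homeoOfIso e).symm ⁻¹' C = e.hom '' C :=
    ((Scheme.homeoOfIso e).toEquiv.image_eq_preimage_symm C).symm
  rw [← h]
  refine preimage_mem_irreducibleComponents hC (Scheme.homeoOfIso e).symm.isOpenEmbedding ?_
  rw [(Scheme.homeoOfIso e).symm.surjective.range_eq, Set.inter_univ]
  exact hC.1.nonempty

/-- The permutation action of the automorphisms of a scheme on its irreducible components. -/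
def componentsPerm (X : Scheme.{u}) : Aut X →* Equiv.Perm (irreducibleComponents X) where
  toFun e :=
   { toFun C := ⟨e.hom '' C.1, image_mem_irreducibleComponents e C.2⟩
     invFun C := ⟨e.inv '' C.1, image_mem_irreducibleComponents e⁻¹ C.2⟩
     left_inv C := Subtype.ext ((Scheme.homeoOfIso e).toEquiv.symm_image_image C.1)
     right_inv C := Subtype.ext ((Scheme.homeoOfIso e).toEquiv.image_symm_image C.1) }
  map_one' := Equiv.ext fun C ↦ Subtype.ext (Set.image_id C.1)
  map_mul' e e' := Equiv.ext fun C ↦ Subtype.ext <|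
    (Set.image_congr fun x _ ↦ Scheme.Hom.comp_apply e'.hom e.hom x).trans
      (Set.image_comp e.hom e'.hom C.1)

variable {Z W : Scheme.{u}} (φ : Z ⟶ W) (D : W)

/-- An algebraic closure `κ̄(D)` of the residue field of a point `D`. -/
abbrev GeomField : Type u := AlgebraicClosure (W.residueField D)

/-- The geometric point `Spec κ̄(D) ⟶ W` above a point `D`. -/
def geometricPoint : Spec (.of (GeomField D)) ⟶ W :=
  Spec.map (CommRingCat.ofHom (algebraMap (W.residueField D) (GeomField D))) ≫
    W.fromSpecResidueField D

/-- The geometric fibre `φ⁻¹(D) ⊗ κ̄(D)`. -/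
abbrev geometricFibre : Scheme.{u} := pullback φ (geometricPoint D)

/-- The absolute Galois group of the residue field `κ(D)`. -/
abbrev GaloisGroup : Type u := Gal(GeomField D/W.residueField D)

variable {D} in
/-- The morphism of `Spec κ̄(D)` induced by a Galois automorphism. -/
def specGalois (σ : GaloisGroup D) : Spec (.of (GeomField D)) ⟶ Spec (.of (GeomField D)) :=
  Spec.map (CommRingCat.ofHom (σ : GeomField D →+* GeomField D))

lemma specGalois_comp (σ : GaloisGroup D) : specGalois σ ≫ geometricPoint D = geometricPoint D := by
  rw [specGalois, geometricPoint, ← Spec.map_comp_assoc, ← CommRingCat.ofHom_comp]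
  congr 3
  ext x
  exact σ.commutes x

variable {D} in
/-- The morphism `id × Spec σ` of the geometric fibre `φ⁻¹(D) ⊗ κ̄(D)`. -/
def geometricFibre.map (σ : GaloisGroup D) : geometricFibre φ D ⟶ geometricFibre φ D :=
  pullback.map _ _ _ _ (𝟙 Z) (specGalois σ) (𝟙 W) (by simp) (by simp [specGalois_comp])

lemma geometricFibre.map_one : geometricFibre.map φ (1 : GaloisGroup D) = 𝟙 _ := by
  have : specGalois (1 : GaloisGroup D) = 𝟙 _ := Spec.map_id _
  ext1 <;> simp [geometricFibre.map, this]

lemma geometricFibre.map_mul (σ τ : GaloisGroup D) :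
    geometricFibre.map φ (σ * τ) = geometricFibre.map φ σ ≫ geometricFibre.map φ τ := by
  have : specGalois (σ * τ) = specGalois σ ≫ specGalois τ := by
    rw [specGalois, specGalois, specGalois, ← Spec.map_comp]
    rfl
  ext1 <;> simp only [geometricFibre.map, this, pullback.lift_fst, pullback.lift_snd, Category.assoc,
    Category.comp_id, pullback.map, pullback.lift_snd_assoc]

/-- The left action of the absolute Galois group on the geometric fibre: `σ` acts as
`id × Spec (σ⁻¹)`. -/
def galoisAut : GaloisGroup D →* Aut (geometricFibre φ D) where
  toFun σ :=
   { hom := geometricFibre.map φ σ⁻¹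
     inv := geometricFibre.map φ σ
     hom_inv_id := by rw [← geometricFibre.map_mul, inv_mul_cancel, geometricFibre.map_one]
     inv_hom_id := by rw [← geometricFibre.map_mul, mul_inv_cancel, geometricFibre.map_one] }
  map_one' := Iso.ext ((congrArg _ inv_one).trans (geometricFibre.map_one φ D))
  map_mul' σ τ := Iso.ext
    ((congrArg _ (mul_inv_rev σ τ)).trans (geometricFibre.map_mul φ D τ⁻¹ σ⁻¹))

/-- The multiplicity of an irreducible component: the length of the local ring at its generic
point. -/
def componentMultiplicity (X : Scheme.{u}) (C : irreducibleComponents X) : ℕ∞ :=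
  Module.length (X.presheaf.stalk C.2.1.genericPoint) (X.presheaf.stalk C.2.1.genericPoint)

/-- The group `Γ_D` through which the absolute Galois group of `κ(D)` acts on the irreducible components
of the geometric fibre: its image in the group of permutations of the components. -/
def actingGroup : Subgroup (Equiv.Perm (irreducibleComponents (geometricFibre φ D))) :=
  ((componentsPerm _).comp (galoisAut φ D)).range

/-- The set `Γ_D°` of those elements of `Γ_D` that fix some irreducible component of multiplicity
one of the geometric fibre. -/
def fixingSet : Set (Equiv.Perm (irreducibleComponents (geometricFibre φ D))) :=
  {γ | γ ∈ actingGroup φ D ∧ ∃ C, componentMultiplicity _ C = 1 ∧ γ C = C}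

/-- `δ_D = #Γ_D° / #Γ_D`. -/
def localDensity : ℚ := Nat.card (fixingSet φ D) / Nat.card (actingGroup φ D)

/-- The set of codimension one points of a scheme. The coheight of a point for the specialisation
order is the Krull dimension of its local ring. -/
def codimOnePoints (W : Scheme.{u}) : Set W := {D | Order.coheight D = 1}

/-- `Δ(φ)`: the sum of `1 - δ_D` over the codimension one points `D` of the target. -/
def invariantDelta : ℚ := ∑ᶠ D : codimOnePoints W, (1 - localDensity φ D.1)

end Fibration

end

/-!
The invariant is a count of the points of codimension one with a reducible geometric fibre, weighted
by `1/2`.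

*Local densities.* Over a point `D` the geometric fibre is the conic `f x² + g y² = z²` with the
values of `f` and `g` in `κ(D)` as coefficients (`conicBundle.isPullback_geomFibre`). If both values
are non-zero, the conic is integral (`DiagonalConic.prime_poly`) and `δ_D = 1`
(`conicBundle.localDensity_of_smooth`). If one value vanishes and the other is some `t²` with
`t ∉ κ(D)`, then the fibre is the union of the two lines `z = ± t y`, which are reduced and
exchanged by any Galois automorphism with `t ↦ -t`. Hence `Γ_D` has order two, only its identity
fixes a component, and `δ_D = 1/2` (`conicBundle.localDensity_of_not_isSquare`).

*The points that contribute.* A chart of `ℙ¹ × ℙ¹` is the spectrum of `ℚ[s][t]`. A point of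
codimension one at which `f(u)` vanishes is there a prime of height one containing a non-zero
polynomial in `s`, so it is the extension of a maximal ideal `𝔷` of `ℚ[s]`
(`eq_map_C_of_height_eq_one`): it is the line above a zero of `f` in `ℙ¹`, and these lines
correspond to the zeros (`bijOn_codimOneZeros`). The residue field of such a line is the function
field `L(t)` with `L = ℚ[s]/𝔷`, in which `g` is not a square, as `disc g ≠ 0` makes it a separable
polynomial of positive degree over `L` (`BinaryQuadraticForm.not_isSquare_of_ker_eq`). So each zero
of `f` contributes `1/2`, and by symmetry so does each zero of `g`; nothing is counted twice, since
`0` is a square.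

*Counting.* A form with non-zero discriminant has two zeros on `ℙ¹` as a scheme over `ℚ` if it
splits over `ℚ`, and otherwise a single zero, with a quadratic residue field
(`BinaryQuadraticForm.ncard_zeros_of_splits`, `BinaryQuadraticForm.ncard_zeros_of_not_splits`).
-/

noncomputable section

open AlgebraicGeometry CategoryTheory Limits MvPolynomial

/-! ### Irreducible components given by their generic points -/

section Topology

variable {T : Type*} [TopologicalSpace T] {x y : T}

lemma closure_mem_irreducibleComponents (h : ∀ z, x ⤳ z ∨ y ⤳ z) (hyx : y ⤳ x → x ⤳ y) :
    closure {x} ∈ irreducibleComponents T := by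
  refine ⟨isIrreducible_singleton.closure, fun Z hZ hle ↦ ?_⟩
  have hxZ : x ∈ Z := hle (subset_closure rfl)
  have hcov : Z ⊆ closure {x} ∪ closure {y} := fun z _ ↦ by
    simpa only [Set.mem_union, specializes_iff_mem_closure] using h z
  rcases (isPreirreducible_iff_isClosed_union_isClosed.mp hZ.2) _ _ isClosed_closure
    isClosed_closure hcov with h₁ | h₁
  · exact h₁
  · exact h₁.trans (hyx (specializes_iff_mem_closure.mpr (h₁ hxZ))).closure_subset

lemma eq_closure_of_mem_irreducibleComponents (h : ∀ z, x ⤳ z ∨ y ⤳ z) {C : Set T}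
    (hC : C ∈ irreducibleComponents T) : C = closure {x} ∨ C = closure {y} := by
  have hcov : C ⊆ closure {x} ∪ closure {y} := fun z _ ↦ by
    simpa only [Set.mem_union, specializes_iff_mem_closure] using h z
  refine (isPreirreducible_iff_isClosed_union_isClosed.mp hC.1.2 _ _ isClosed_closure
    isClosed_closure hcov).imp (fun h₁ ↦ ?_) (fun h₁ ↦ ?_) <;>
  exact h₁.antisymm (hC.2 isIrreducible_singleton.closure h₁)

end Topology

namespace Fibration

universe u

lemma componentMultiplicity_eq_one {X : Scheme.{u}} (C : irreducibleComponents X) {x : X}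
    (hx : closure {x} = C.1) (h : IsField (X.presheaf.stalk x)) :
    componentMultiplicity X C = 1 := by
  have e : C.2.1.genericPoint = x := by
    have h₁ : IsGenericPoint C.2.1.genericPoint (closure C.1) :=
      C.2.1.isGenericPoint_genericPoint_closure
    have h₂ : IsGenericPoint x (closure C.1) := by
      rw [← hx, closure_closure]
      exact isGenericPoint_closure
    exact h₁.eq h₂
  rw [componentMultiplicity, e, Module.length_eq_one_iff, isSimpleModule_self_iff_isUnit]
  have := h.nontrivial
  refine ⟨this, fun a ha ↦ ?_⟩
  obtain ⟨b, hb⟩ := h.mul_inv_cancel ha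
  exact .of_mul_eq_one b hb

variable {Z W : Scheme.{u}} (φ : Z ⟶ W) (D : W)

/-- A geometric fibre that is irreducible and generically reduced has `δ_D = 1`. -/
lemma localDensity_eq_one {x : geometricFibre φ D} (h : ∀ z, x ⤳ z)
    (hx : IsField ((geometricFibre φ D).presheaf.stalk x)) :
    Finite (actingGroup φ D) ∧ localDensity φ D = 1 := by
  have h' (z) : x ⤳ z ∨ x ⤳ z := .inl (h z)
  let C : irreducibleComponents (geometricFibre φ D) :=
    ⟨closure {x}, closure_mem_irreducibleComponents h' id⟩
  have : Unique (irreducibleComponents (geometricFibre φ D)) :=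
    ⟨⟨C⟩, fun C' ↦ Subtype.ext ((eq_closure_of_mem_irreducibleComponents h' C'.2).elim id id)⟩
  refine ⟨inferInstance, ?_⟩
  have h₁ : fixingSet φ D = {1} := by
    refine Set.eq_singleton_iff_unique_mem.mpr ⟨⟨one_mem _, C, ?_, rfl⟩, fun _ _ ↦
      Subsingleton.elim _ _⟩
    exact componentMultiplicity_eq_one C rfl hx
  have h₂ : Nat.card (actingGroup φ D) = 1 := Nat.card_of_subsingleton 1
  rw [localDensity, h₁, h₂]
  simp

/-- A generically reduced geometric fibre with exactly two components has `δ_D = 1 / 2` when some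
Galois automorphism exchanges them: `Γ_D` is the full symmetric group on the two components, and
of its two elements only the identity fixes a component. -/
lemma localDensity_eq_half {x y : geometricFibre φ D} (h : ∀ z, x ⤳ z ∨ y ⤳ z)
    (hxy : ¬ x ⤳ y) (hyx : ¬ y ⤳ x)
    (hx : IsField ((geometricFibre φ D).presheaf.stalk x))
    (σ : GaloisGroup D) (hσ : geometricFibre.map φ σ x = y) :
    Finite (actingGroup φ D) ∧ localDensity φ D = 1 / 2 := by
  let C : irreducibleComponents (geometricFibre φ D) :=
    ⟨closure {x}, closure_mem_irreducibleComponents h fun h ↦ absurd h hyx⟩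
  let C' : irreducibleComponents (geometricFibre φ D) :=
    ⟨closure {y}, closure_mem_irreducibleComponents (fun z ↦ (h z).symm) fun h ↦ absurd h hxy⟩
  have hne : C ≠ C' := fun e ↦ hyx <| by
    rw [specializes_iff_mem_closure, ← show closure {x} = closure {y} from congrArg Subtype.val e]
    exact subset_closure rfl
  have hall (B : irreducibleComponents (geometricFibre φ D)) : B = C ∨ B = C' :=
    (eq_closure_of_mem_irreducibleComponents h B.2).imp Subtype.ext Subtype.ext
  have huniv : (Set.univ : Set (irreducibleComponents (geometricFibre φ D))) = {C, C'} :=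
    (Set.eq_univ_of_forall hall).symm
  have hcard : Nat.card (irreducibleComponents (geometricFibre φ D)) = 2 := by
    rw [← Set.ncard_univ, huniv, Set.ncard_pair hne]
  have hfin : Finite (irreducibleComponents (geometricFibre φ D)) :=
    Nat.finite_of_card_ne_zero (by rw [hcard]; simp)
  refine ⟨inferInstance, ?_⟩
  -- the permutation induced by `σ⁻¹`, which acts as `id × Spec σ`
  let γ : Equiv.Perm (irreducibleComponents (geometricFibre φ D)) :=
    componentsPerm _ (galoisAut φ D σ⁻¹)
  have hγmem : γ ∈ actingGroup φ D := ⟨σ⁻¹, rfl⟩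
  have hγ : γ C = C' := by
    have hmap : (galoisAut φ D σ⁻¹).hom = geometricFibre.map φ σ :=
      congrArg (geometricFibre.map φ) (inv_inv σ)
    refine Subtype.ext ?_
    change (galoisAut φ D σ⁻¹).hom '' closure {x} = closure {y}
    have := (Scheme.homeoOfIso (galoisAut φ D σ⁻¹)).image_closure {x}
    rw [Set.image_singleton] at this
    refine this.trans ?_
    rw [← hσ, ← hmap]
    rfl
  have heq_one {τ : Equiv.Perm (irreducibleComponents (geometricFibre φ D))}
      (B) (hB : τ B = B) : τ = 1 := by
    have key : ∀ A B, A ≠ B → (∀ E, E = A ∨ E = B) → τ A = A → τ = 1 := by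
      intro A B hAB hE hA
      refine Equiv.ext fun E ↦ ?_
      rcases hE E with rfl | rfl
      · exact hA
      · refine (hE (τ E)).resolve_left fun h₁ ↦ hAB ?_
        exact τ.injective (hA.trans h₁.symm)
    rcases hall B with rfl | rfl
    · exact key _ _ hne hall hB
    · exact key _ _ hne.symm (fun E ↦ (hall E).symm) hB
  have h₁ : fixingSet φ D = {1} := by
    refine Set.eq_singleton_iff_unique_mem.mpr ⟨⟨one_mem _, C, ?_, rfl⟩, ?_⟩
    · exact componentMultiplicity_eq_one C rfl hx
    · rintro τ ⟨-, B, -, hB⟩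
      exact heq_one B hB
  have h₂ : Nat.card (actingGroup φ D) = 2 := by
    have hle : Nat.card (actingGroup φ D) ≤ 2 := by
      refine (Subgroup.card_le_card_group _).trans_eq ?_
      rw [Nat.card_perm, hcard]
      rfl
    have : Nontrivial (actingGroup φ D) := ⟨1, ⟨γ, hγmem⟩, fun e ↦ hne <| by
      rw [← hγ, ← show 1 = γ from congrArg Subtype.val e]
      rfl⟩
    exact hle.antisymm Finite.one_lt_card
  rw [localDensity, h₁, h₂]
  simp

end Fibration

/-! ### Points of `Proj` -/

namespace ProjPoint

universe u

variable {σ : Type*} {A : Type u} [CommRing A] [SetLike σ A] [AddSubgroupClass σ A]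
  {𝒜 : ℕ → σ} [GradedRing 𝒜]

/-- The homogeneous prime ideal of a point of `Proj`. -/
abbrev ideal (x : Proj 𝒜) : HomogeneousIdeal 𝒜 := ProjectiveSpectrum.asHomogeneousIdeal (𝒜 := 𝒜) x

instance (x : Proj 𝒜) : (ideal x).toIdeal.IsPrime := ProjectiveSpectrum.isPrime (𝒜 := 𝒜) x

lemma specializes_iff (x y : Proj 𝒜) :
    x ⤳ y ↔ (ideal x).toIdeal ≤ (ideal y).toIdeal := by
  rw [specializes_iff_mem_closure]
  exact (ProjectiveSpectrum.le_iff_mem_closure (𝒜 := 𝒜) x y).symm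

/-- The local ring at a point of `Proj` is a field if some element outside the prime ideal of the
point annihilates this ideal. -/
lemma isField_stalk (x : Proj 𝒜) {t : A}
    (ht : t ∉ ideal x)
    (h : ∀ a ∈ ideal x, t * a = 0) :
    IsField ((Proj 𝒜).presheaf.stalk x) := by
  refine MulEquiv.isField ?_ (Proj.stalkIso 𝒜 x).commRingCatIsoToRingEquiv.toMulEquiv
  refine ⟨exists_pair_ne _, mul_comm, fun {z} hz ↦ ?_⟩
  obtain ⟨c, rfl⟩ := HomogeneousLocalization.mk_surjective z
  suffices IsUnit (HomogeneousLocalization.mk c) from this.exists_right_inv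
  rw [← HomogeneousLocalization.isUnit_iff_isUnit_val, HomogeneousLocalization.val_mk,
    Localization.mk_eq_mk', IsLocalization.AtPrime.isUnit_mk'_iff
      (Localization.AtPrime (ideal x).toIdeal) (ideal x).toIdeal]
  intro hc
  refine hz (HomogeneousLocalization.val_injective _ ?_)
  rw [HomogeneousLocalization.val_mk, HomogeneousLocalization.val_zero, Localization.mk_eq_mk',
    IsLocalization.mk'_eq_zero_iff]
  exact ⟨⟨t, ht⟩, h _ hc⟩

end ProjPoint

/-! ### Conics over a field -/

namespace DiagonalConic

variable {K : Type} [Field K] {a : Fin 3 → K}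

section Degenerate

variable {k m n : Fin 3} {t : K} (hp : poly a = C (t ^ 2) * X m ^ 2 - X n ^ 2) (hmn : m ≠ n)

include hp hmn in
lemma aeval_poly_eq_zero :
    aeval (Function.update (X : Fin 3 → MvPolynomial (Fin 3) K) n (C t * X m)) (poly a) = 0 := by
  rw [hp]
  simp only [map_sub, map_mul, map_pow, aeval_X, Function.update_self, Function.update_of_ne hmn,
    algHom_C, algebraMap_eq]
  ring

/-- Restriction of functions from the degenerate conic `t² xₘ² = xₙ²` to its component
`xₙ = t xₘ`: the homomorphism that substitutes `t xₘ` for `xₙ`. -/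
def restrictToLine : CoordRing a →+* MvPolynomial (Fin 3) K :=
  Ideal.Quotient.lift _
    (aeval (Function.update (X : Fin 3 → MvPolynomial (Fin 3) K) n (C t * X m))).toRingHom
    (by
      suffices Ideal.span {poly a} ≤ RingHom.ker (aeval (Function.update
        (X : Fin 3 → MvPolynomial (Fin 3) K) n (C t * X m))).toRingHom from fun p hp ↦ this hp
      rw [Ideal.span_singleton_le_iff_mem]
      exact aeval_poly_eq_zero hp hmn)

lemma restrictToLine_mk (p : MvPolynomial (Fin 3) K) : restrictToLine hp hmn (mk a p) =
    aeval (Function.update (X : Fin 3 → MvPolynomial (Fin 3) K) n (C t * X m)) p := rfl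

lemma ker_restrictToLine : RingHom.ker (restrictToLine hp hmn) =
    Ideal.span {mk a (C t * X m - X n)} := by
  refine le_antisymm (fun p h ↦ ?_) ?_
  · obtain ⟨p, rfl⟩ := Ideal.Quotient.mkₐ_surjective K _ p
    rw [RingHom.mem_ker, restrictToLine_mk] at h
    let q : MvPolynomial (Fin 3) K →ₐ[K] CoordRing a ⧸ Ideal.span {mk a (C t * X m - X n)} :=
      (Ideal.Quotient.mkₐ K _).comp (mk a)
    have hq : q.comp (aeval (Function.update (X : Fin 3 → MvPolynomial (Fin 3) K) n (C t * X m))) =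
        q := by
      refine MvPolynomial.algHom_ext fun i ↦ ?_
      rw [AlgHom.comp_apply, aeval_X]
      rcases eq_or_ne i n with rfl | hi
      · rw [Function.update_self, ← sub_eq_zero, ← map_sub]
        exact Ideal.Quotient.eq_zero_iff_mem.mpr (Ideal.mem_span_singleton_self _)
      · rw [Function.update_of_ne hi]
    have := DFunLike.congr_fun hq p
    rw [AlgHom.comp_apply, h, map_zero] at this
    exact Ideal.Quotient.eq_zero_iff_mem.mp this.symm
  · rw [Ideal.span_singleton_le_iff_mem, RingHom.mem_ker, restrictToLine_mk]
    simp [Function.update_of_ne hmn]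

lemma linear_mem (t : K) : mk a (C t * X m - X n) ∈ grading a 1 :=
  mk_mem a (((isHomogeneous_C (Fin 3) t).mul (isHomogeneous_X K m)).sub (isHomogeneous_X K n))

/-- The generic point of the component `xₙ = t xₘ` of the conic `t² xₘ² = xₙ²`. -/
def linePoint (hkn : k ≠ n) : scheme a := show ProjectiveSpectrum (grading a) from
  { asHomogeneousIdeal := ⟨RingHom.ker (restrictToLine hp hmn), by
      rw [ker_restrictToLine]
      exact Ideal.homogeneous_span _ _ (by rintro _ rfl; exact ⟨1, linear_mem t⟩)⟩
    isPrime := RingHom.ker_isPrime _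
    not_irrelevant_le := fun h ↦ by
      have : coord a k ∈ RingHom.ker (restrictToLine hp hmn) :=
        h (HomogeneousIdeal.mem_irrelevant_of_mem _ one_pos (coord_mem a k))
      rw [RingHom.mem_ker, coord, restrictToLine_mk, aeval_X, Function.update_of_ne hkn] at this
      exact X_ne_zero k this }

lemma mem_linePoint (hkn : k ≠ n) (p : CoordRing a) :
    p ∈ ProjPoint.ideal (linePoint hp hmn hkn) ↔
      restrictToLine hp hmn p = 0 := Iff.rfl

lemma linePoint_specializes_iff (hkn : k ≠ n) (x : scheme a) : linePoint hp hmn hkn ⤳ x ↔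
    mk a (C t * X m - X n) ∈ ProjPoint.ideal x := by
  rw [ProjPoint.specializes_iff]
  change RingHom.ker (restrictToLine hp hmn) ≤ HomogeneousIdeal.toIdeal _ ↔ _
  rw [ker_restrictToLine, Ideal.span_singleton_le_iff_mem]
  rfl

variable (hp' : poly a = C ((-t) ^ 2) * X m ^ 2 - X n ^ 2)

include hp in
lemma linear_mul_linear : mk a (C t * X m - X n) * mk a (C (-t) * X m - X n) = 0 := by
  rw [← map_mul]
  refine Ideal.Quotient.eq_zero_iff_mem.mpr (Ideal.mem_span_singleton'.mpr ⟨-1, ?_⟩)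
  rw [hp, map_neg, map_pow]
  ring

lemma linePoint_specializes_or (hkn : k ≠ n) (x : scheme a) :
    linePoint hp hmn hkn ⤳ x ∨ linePoint hp' hmn hkn ⤳ x := by
  rw [linePoint_specializes_iff, linePoint_specializes_iff]
  refine Ideal.IsPrime.mem_or_mem (I := (ProjPoint.ideal x).toIdeal) inferInstance ?_
  rw [linear_mul_linear hp]
  exact zero_mem _

lemma not_linePoint_specializes (hkn : k ≠ n) (h2 : (2 : K) ≠ 0) (ht : t ≠ 0) :
    ¬ linePoint hp hmn hkn ⤳ linePoint hp' hmn hkn := by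
  rw [linePoint_specializes_iff, mem_linePoint, restrictToLine_mk]
  simp only [map_sub, map_mul, aeval_X, Function.update_self, Function.update_of_ne hmn,
    algHom_C, algebraMap_eq]
  have e : C t * X m - C (-t) * X m = C (2 * t) * (X m : MvPolynomial (Fin 3) K) := by
    simp only [map_mul, map_neg, map_ofNat]; ring
  rw [e]
  exact mul_ne_zero ((map_ne_zero_iff _ (C_injective _ _)).mpr (mul_ne_zero h2 ht)) (X_ne_zero m)

lemma isField_stalk_linePoint (hkn : k ≠ n) (h2 : (2 : K) ≠ 0) (ht : t ≠ 0) :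
    IsField ((scheme a).presheaf.stalk (linePoint hp hmn hkn)) := by
  have hp' : poly a = C ((-t) ^ 2) * X m ^ 2 - X n ^ 2 := by rw [hp, neg_sq]
  have hp'' : poly a = C ((- -t) ^ 2) * X m ^ 2 - X n ^ 2 := by rw [hp, neg_neg]
  refine ProjPoint.isField_stalk _ (t := mk a (C (-t) * X m - X n)) ?_ fun b hb ↦ ?_
  · have := not_linePoint_specializes hp' hmn hp'' hkn h2 (neg_ne_zero.mpr ht)
    rw [linePoint_specializes_iff] at this
    simpa only [neg_neg] using this
  · replace hb : b ∈ RingHom.ker (restrictToLine hp hmn) := hb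
    rw [ker_restrictToLine, Ideal.mem_span_singleton'] at hb
    obtain ⟨c, rfl⟩ := hb
    rw [mul_left_comm, mul_comm (mk a _), linear_mul_linear hp, mul_zero]

/-- A field automorphism `σ` with `σ t = -t` that fixes the coefficients exchanges the two
components of the conic `t² xₘ² = xₙ²`. -/
lemma map_linePoint (hkn : k ≠ n) (σ : K →+* K) (hσ : σ t = -t)
    (h : ∀ i, σ (a i) * 1 ^ 2 = a i) :
    map σ (fun _ ↦ 1) h (fun _ ↦ isUnit_one) (linePoint hp hmn hkn) = linePoint hp' hmn hkn := by
  have key : (restrictToLine hp hmn).comp (ringHom σ (fun _ ↦ 1) h) =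
      (MvPolynomial.map σ).comp (restrictToLine hp' hmn) := by
    refine ringHom_ext (fun b ↦ ?_) fun i ↦ ?_
    · rw [RingHom.comp_apply, RingHom.comp_apply, ringHom_algebraMap]
      change restrictToLine hp hmn (mk a (C (σ b))) =
        MvPolynomial.map σ (restrictToLine hp' hmn (mk a (C b)))
      rw [restrictToLine_mk, restrictToLine_mk, algHom_C, algHom_C, algebraMap_eq, map_C]
    · rw [RingHom.comp_apply, RingHom.comp_apply, ringHom_coord, map_one, one_mul, coord,
        restrictToLine_mk, restrictToLine_mk, aeval_X, aeval_X]
      rcases eq_or_ne i n with rfl | hi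
      · simp [hσ]
      · simp [Function.update_of_ne hi]
  refine ProjectiveSpectrum.ext (HomogeneousIdeal.ext (Ideal.ext fun p ↦ ?_))
  change restrictToLine hp hmn (ringHom σ (fun _ ↦ 1) h p) = 0 ↔ restrictToLine hp' hmn p = 0
  rw [← RingHom.comp_apply, key, RingHom.comp_apply]
  exact map_eq_zero_iff _ (MvPolynomial.map_injective σ σ.injective)

end Degenerate

section Smooth

/-- A ternary diagonal form with non-zero coefficients is irreducible in characteristic not two.
Up to a unit it is a monic polynomial of degree two in the first variable, so it suffices that
`-q`, for `q` a diagonal form in the last two variables, is not a square. A square root of `-q`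
would divide the partial derivatives of `q` and hence both variables. -/
lemma prime_poly (h2 : (2 : K) ≠ 0) (ha : ∀ i, a i ≠ 0) : Prime (poly a) := by
  let q : MvPolynomial (Fin 2) K := C (a 1 / a 0) * X 0 ^ 2 + C (a 2 / a 0) * X 1 ^ 2
  have hq : finSuccEquiv K 2 (poly a) =
      Polynomial.C (C (a 0)) * (Polynomial.X ^ 2 + Polynomial.C q) := by
    have h (i : Fin 3) : (C (a i) : MvPolynomial (Fin 2) K) = C (a 0) * C (a i / a 0) := by
      rw [← map_mul, mul_div_cancel₀ _ (ha 0)]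
    simp only [poly, Fin.sum_univ_three, map_add, map_mul, map_pow]
    rw [finSuccEquiv_X_zero, show (1 : Fin 3) = Fin.succ 0 from rfl,
      show (2 : Fin 3) = Fin.succ 1 from rfl, finSuccEquiv_X_succ, finSuccEquiv_X_succ]
    simp only [finSuccEquiv_apply, eval₂Hom_C, RingHom.comp_apply]
    simp only [Fin.succ_zero_eq_one, Fin.succ_one_eq_two]
    rw [h 1, h 2]
    simp only [q, map_add, map_mul, map_pow]
    ring
  have hirr : Irreducible (Polynomial.X ^ 2 + Polynomial.C q) := by
    have hmonic : (Polynomial.X ^ 2 + Polynomial.C q).Monic :=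
      Polynomial.monic_X_pow_add_C q two_ne_zero
    have hdeg : (Polynomial.X ^ 2 + Polynomial.C q).natDegree = 2 :=
      Polynomial.natDegree_X_pow_add_C
    rw [hmonic.irreducible_iff_roots_eq_zero_of_degree_le_three hdeg.ge (by rw [hdeg]; simp)]
    refine Multiset.eq_zero_of_forall_notMem fun r hr ↦ ?_
    have hr : r ^ 2 = -q := by
      have := (Polynomial.mem_roots'.mp hr).2
      simp only [Polynomial.IsRoot, Polynomial.eval_add, Polynomial.eval_pow, Polynomial.eval_X,
        Polynomial.eval_C] at this
      linear_combination this
    have hdvd (i : Fin 2) {b : K} (hb : b ≠ 0) (h : pderiv i (-q) = C b * X i) : r ∣ X i := by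
      rw [← hr, Derivation.leibniz_pow] at h
      have h' : r ∣ C b * X i := by
        rw [← h]
        refine (Dvd.intro (2 * pderiv i r) ?_)
        simp
        ring
      exact (((isUnit_iff_ne_zero.mpr hb).map C).dvd_mul_left).mp h'
    have h0 : r ∣ X 0 := by
      refine hdvd 0 (b := -(2 * (a 1 / a 0))) ?_ ?_
      · exact neg_ne_zero.mpr (mul_ne_zero h2 (div_ne_zero (ha 1) (ha 0)))
      · simp [q, Derivation.leibniz_pow, show (C 2 : MvPolynomial (Fin 2) K) = 2 from map_ofNat C 2]
        ring
    have h1 : r ∣ X 1 := by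
      refine hdvd 1 (b := -(2 * (a 2 / a 0))) ?_ ?_
      · exact neg_ne_zero.mpr (mul_ne_zero h2 (div_ne_zero (ha 2) (ha 0)))
      · simp [q, Derivation.leibniz_pow, show (C 2 : MvPolynomial (Fin 2) K) = 2 from map_ofNat C 2]
        ring
    have hunit : IsUnit r := by
      by_contra hu
      have := ((X_prime (R := K) (i := (0 : Fin 2))).irreducible.dvd_iff.mp h0).resolve_left hu
      exact absurd (X_dvd_X.mp (this.dvd.trans h1)) zero_ne_one
    have := (hunit.pow 2).map constantCoeff
    rw [hr] at this
    simp [q] at this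
  rw [← MulEquiv.prime_iff (finSuccEquiv K 2).toMulEquiv]
  refine Irreducible.prime ?_
  change Irreducible (finSuccEquiv K 2 (poly a))
  rw [hq]
  exact (irreducible_isUnit_mul (((isUnit_iff_ne_zero.mpr (ha 0)).map C).map Polynomial.C)).mpr hirr

/-- A smooth conic has a generic point, and its local ring there is a field. -/
lemma exists_generic (h2 : (2 : K) ≠ 0) (ha : ∀ i, a i ≠ 0) :
    ∃ x : scheme a, (∀ z, x ⤳ z) ∧ IsField ((scheme a).presheaf.stalk x) := by
  have hpr := prime_poly h2 ha
  have hprime := (Ideal.span_singleton_prime hpr.ne_zero).mpr hpr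
  have : IsDomain (CoordRing a) := Ideal.Quotient.isDomain _
  have hcoord : coord a 0 ≠ 0 := fun h ↦ by
    have h₁ : poly a ∣ X 0 := Ideal.mem_span_singleton.mp (Ideal.Quotient.eq_zero_iff_mem.mp h)
    obtain ⟨c, hc⟩ := (hpr.irreducible.associated_of_dvd X_prime.irreducible h₁).symm.dvd
    have := congrArg (eval (Pi.single 1 1)) hc
    simp [poly, Fin.sum_univ_three, ha 1] at this
  let x : ProjectiveSpectrum (grading a) :=
    { asHomogeneousIdeal := ⊥
      isPrime := Ideal.isPrime_bot
      not_irrelevant_le := fun h ↦ hcoord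
        (h (HomogeneousIdeal.mem_irrelevant_of_mem _ one_pos (coord_mem a 0))) }
  refine ⟨x, fun z ↦ (ProjPoint.specializes_iff _ _).mpr ?_,
    ProjPoint.isField_stalk (𝒜 := grading a) x (t := 1) ?_ ?_⟩
  · exact bot_le (α := Ideal _)
  · exact one_ne_zero
  · intro b hb
    rw [one_mul]
    exact hb

end Smooth

end DiagonalConic

/-! ### The geometric fibres of the conic bundle -/

lemma fromSpecResidueField_eq {X : Scheme.{0}} {U : X.Opens} (hU : IsAffineOpen U) {D : X}
    (hD : D ∈ U) : X.fromSpecResidueField D = Spec.map (X.evaluation U D hD) ≫ hU.fromSpec := by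
  rw [Scheme.fromSpecResidueField, Scheme.evaluation, Spec.map_comp, Category.assoc,
    ← hU.fromSpecStalk_eq_fromSpecStalk hD]
  rfl

instance charZero_residueField (D : P1xP1) : CharZero (P1xP1.residueField D) :=
  charZero_of_injective_ringHom (R := ℚ) (Spec.preimage
    (P1xP1.fromSpecResidueField D ≫ P1xP1.fst ≫ P1.toSpec)).hom.injective

section Iso

variable {X Y : Scheme.{0}} (e : X ≅ Y)

lemma isField_stalk_of_iso (x : X) (h : IsField (Y.presheaf.stalk (e.hom x))) :
    IsField (X.presheaf.stalk x) :=
  (asIso (e.hom.stalkMap x)).commRingCatIsoToRingEquiv.symm.toMulEquiv.isField h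

lemma specializes_hom_iff (x z : X) : e.hom x ⤳ e.hom z ↔ x ⤳ z :=
  (Scheme.homeoOfIso e).isInducing.specializes_iff

lemma iso_hom_inv_apply (y : Y) : e.hom (e.inv y) = y := by
  rw [← Scheme.Hom.comp_apply, e.inv_hom_id]
  rfl

end Iso

namespace conicBundle

open Patch

variable (f g : BinaryQuadraticForm) (P : Patch) {D : P1xP1} (hD : D ∈ P.U)

/-- The inclusion of the conic over a patch into the total space. -/
def patchInclusion : DiagonalConic.scheme (coeffs f g P) ⟶ conicBundle f g :=
  colimit.ι (gluingData f g).functor P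

lemma isPullback_patchInclusion : IsPullback (patchInclusion f g P) (structureMap f g P)
    (conicBundle.π f g) P.U.ι :=
  ((gluingData f g).isPullback_natTrans_ι_toBase P).flip

/-- The value of a function on a patch at a geometric point. -/
def geomEval : Γ(P1xP1, P.U) →+* Fibration.GeomField D :=
  (algebraMap (P1xP1.residueField D) (Fibration.GeomField D)).comp
    (P1xP1.evaluation P.U D hD).hom

/-- The coefficients of the geometric fibre as a conic. -/
def geomCoeffs (i : Fin 3) : Fibration.GeomField D := geomEval P hD (coeffs f g P i)

lemma geomCoeffs_eq (i : Fin 3) :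
    geomEval P hD (coeffs f g P i) * 1 ^ 2 = geomCoeffs f g P hD i := by
  rw [one_pow, mul_one, geomCoeffs]

/-- The geometric fibre is a diagonal conic. -/
lemma isPullback_geomFibre : IsPullback
    (DiagonalConic.map (geomEval P hD) (fun _ ↦ 1) (geomCoeffs_eq f g P hD) (fun _ ↦ isUnit_one) ≫
      patchInclusion f g P)
    (DiagonalConic.toSpec (geomCoeffs f g P hD)) (conicBundle.π f g)
    (Fibration.geometricPoint D) := by
  have h₁ := DiagonalConic.isPullback (geomEval P hD) (fun _ ↦ 1) (geomCoeffs_eq f g P hD)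
    (fun _ ↦ isUnit_one)
  have h₂ : IsPullback (𝟙 (DiagonalConic.scheme (coeffs f g P)))
      (DiagonalConic.toSpec (coeffs f g P)) (structureMap f g P) P.isAffine.isoSpec.inv :=
    .of_horiz_isIso ⟨by rw [Category.id_comp]; rfl⟩
  have h₃ := (h₁.paste_horiz h₂).paste_horiz (isPullback_patchInclusion f g P)
  rw [Category.comp_id, Category.assoc, P.isAffine.isoSpec_inv_ι] at h₃
  rw [Fibration.geometricPoint, fromSpecResidueField_eq P.isAffine hD, ← Spec.map_comp_assoc]
  exact h₃

/-- The isomorphism of the geometric fibre with a diagonal conic. -/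
def geomFibreIso : Fibration.geometricFibre (conicBundle.π f g) D ≅
    DiagonalConic.scheme (geomCoeffs f g P hD) :=
  (isPullback_geomFibre f g P hD).isoPullback.symm

lemma galois_geomCoeffs (σ : Fibration.GaloisGroup D) (i : Fin 3) :
    (σ : Fibration.GeomField D →+* Fibration.GeomField D) (geomCoeffs f g P hD i) * 1 ^ 2 =
      geomCoeffs f g P hD i := by
  rw [one_pow, mul_one]
  exact σ.commutes _

/-- Under `geomFibreIso` the Galois action is the action on the coefficients of equations. -/
lemma map_comp_geomFibreIso (σ : Fibration.GaloisGroup D) :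
    DiagonalConic.map (σ : Fibration.GeomField D →+* Fibration.GeomField D) (fun _ ↦ 1)
      (galois_geomCoeffs f g P hD σ) (fun _ ↦ isUnit_one) ≫ (geomFibreIso f g P hD).inv =
    (geomFibreIso f g P hD).inv ≫ Fibration.geometricFibre.map (conicBundle.π f g) σ := by
  have hfst : (geomFibreIso f g P hD).inv ≫ pullback.fst _ _ = _ :=
    (isPullback_geomFibre f g P hD).isoPullback_hom_fst
  have hsnd : (geomFibreIso f g P hD).inv ≫ pullback.snd _ _ = _ :=
    (isPullback_geomFibre f g P hD).isoPullback_hom_snd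
  refine pullback.hom_ext ?_ ?_
  · rw [Category.assoc, Category.assoc, Fibration.geometricFibre.map, pullback.map,
      pullback.lift_fst, Category.comp_id, hfst, ← Category.assoc]
    congr 1
    have hσ : (σ : Fibration.GeomField D →+* Fibration.GeomField D).comp (geomEval P hD) =
        geomEval P hD := RingHom.ext fun x ↦ σ.commutes _
    rw [DiagonalConic.map_comp _ _ (fun i ↦ by
      rw [hσ, map_one, one_mul, geomCoeffs_eq])
      (fun _ ↦ by rw [map_one, one_mul]; exact isUnit_one)]
    exact DiagonalConic.map_eq_of_eq _ _ _ _ _ (by simp) hσ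
  · rw [Category.assoc, Category.assoc, Fibration.geometricFibre.map, pullback.map,
      pullback.lift_snd, hsnd, ← Category.assoc, hsnd, DiagonalConic.map_toSpec]
    rfl

lemma geomCoeffs_eq_zero_iff (i : Fin 3) : geomCoeffs f g P hD i = 0 ↔
    P1xP1.evaluation P.U D hD (coeffs f g P i) = 0 :=
  map_eq_zero_iff _ (algebraMap (P1xP1.residueField D) (Fibration.GeomField D)).injective

/-- Over a point where no coefficient vanishes the fibre is a smooth conic. -/
theorem localDensity_of_smooth (h : ∀ i, P1xP1.evaluation P.U D hD (coeffs f g P i) ≠ 0) :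
    Finite (Fibration.actingGroup (conicBundle.π f g) D) ∧
      Fibration.localDensity (conicBundle.π f g) D = 1 := by
  have : CharZero (Fibration.GeomField D) := charZero_of_injective_algebraMap
    (algebraMap (P1xP1.residueField D) (Fibration.GeomField D)).injective
  obtain ⟨x, hx, hfield⟩ := DiagonalConic.exists_generic (a := geomCoeffs f g P hD) two_ne_zero
    fun i ↦ (geomCoeffs_eq_zero_iff f g P hD i).not.mpr (h i)
  let e := geomFibreIso f g P hD
  refine Fibration.localDensity_eq_one _ _ (x := e.inv x) (fun z ↦ ?_) ?_
  · rw [← specializes_hom_iff e, iso_hom_inv_apply]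
    exact hx _
  · refine isField_stalk_of_iso e _ ?_
    rw [iso_hom_inv_apply]
    exact hfield

/-- Over a point where one of the first two coefficients vanishes, and the other one is not a
square in the residue field, the fibre consists of two conjugate lines. -/
theorem localDensity_of_not_isSquare {k m : Fin 3} (hkm : k ≠ m) (hk : k ≠ 2) (hm : m ≠ 2)
    (h₀ : P1xP1.evaluation P.U D hD (coeffs f g P k) = 0)
    (h : ¬ IsSquare (P1xP1.evaluation P.U D hD (coeffs f g P m))) :
    Finite (Fibration.actingGroup (conicBundle.π f g) D) ∧
      Fibration.localDensity (conicBundle.π f g) D = 1 / 2 := by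
  have : CharZero (Fibration.GeomField D) := charZero_of_injective_algebraMap
    (algebraMap (P1xP1.residueField D) (Fibration.GeomField D)).injective
  obtain ⟨t, ht⟩ := IsAlgClosed.exists_pow_nat_eq (geomCoeffs f g P hD m) two_pos
  obtain ⟨σ, hσ⟩ : ∃ σ : Fibration.GaloisGroup D, σ t ≠ t := by
    by_contra! hfix
    obtain ⟨s, hs⟩ := (InfiniteGalois.mem_range_algebraMap_iff_fixed t).mpr hfix
    refine h ⟨s, ?_⟩
    apply (algebraMap (P1xP1.residueField D) (Fibration.GeomField D)).injective
    rw [map_mul, hs, ← sq, ht]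
    rfl
  have hσ' : σ t = -t := by
    have : σ t ^ 2 = t ^ 2 := by
      rw [← map_pow, ht]
      exact σ.commutes _
    exact (sq_eq_sq_iff_eq_or_eq_neg.mp this).resolve_left hσ
  have ht0 : t ≠ 0 := by
    rintro rfl
    exact hσ (map_zero σ)
  have h2 : geomCoeffs f g P hD 2 = -1 := by
    change geomEval P hD (-1) = -1
    rw [map_neg, map_one]
  have hp : DiagonalConic.poly (geomCoeffs f g P hD) = C (t ^ 2) * X m ^ 2 - X 2 ^ 2 := by
    have h₀' := (geomCoeffs_eq_zero_iff f g P hD k).mpr h₀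
    rw [ht, DiagonalConic.poly, Fin.sum_univ_three, h2]
    fin_cases k <;> fin_cases m <;> simp_all [sub_eq_add_neg]
  have hp' : DiagonalConic.poly (geomCoeffs f g P hD) = C ((-t) ^ 2) * X m ^ 2 - X 2 ^ 2 := by
    rw [hp, neg_sq]
  let e := geomFibreIso f g P hD
  refine Fibration.localDensity_eq_half _ _ (x := e.inv (DiagonalConic.linePoint hp hm hk))
    (y := e.inv (DiagonalConic.linePoint hp' hm hk)) (fun z ↦ ?_) ?_ ?_ ?_ σ ?_
  · rw [← specializes_hom_iff e, ← specializes_hom_iff e, iso_hom_inv_apply, iso_hom_inv_apply]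
    exact DiagonalConic.linePoint_specializes_or hp hm hp' hk _
  · rw [← specializes_hom_iff e, iso_hom_inv_apply, iso_hom_inv_apply]
    exact DiagonalConic.not_linePoint_specializes hp hm hp' hk two_ne_zero ht0
  · rw [← specializes_hom_iff e, iso_hom_inv_apply, iso_hom_inv_apply]
    have hp'' : DiagonalConic.poly (geomCoeffs f g P hD) = C ((- -t) ^ 2) * X m ^ 2 - X 2 ^ 2 := by
      rw [hp, neg_neg]
    have := DiagonalConic.not_linePoint_specializes hp' hm hp'' hk two_ne_zero (neg_ne_zero.mpr ht0)
    simpa only [neg_neg] using this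
  · refine isField_stalk_of_iso e _ ?_
    rw [iso_hom_inv_apply]
    exact DiagonalConic.isField_stalk_linePoint hp hm hk two_ne_zero ht0
  · rw [← Scheme.Hom.comp_apply, ← map_comp_geomFibreIso, Scheme.Hom.comp_apply]
    exact congrArg _ (DiagonalConic.map_linePoint hp hm hp' hk _ hσ' _)

end conicBundle

/-! ### The affine charts of the projective line -/

namespace ProjPoint

universe u

variable {σ : Type*} {A : Type u} [CommRing A] [SetLike σ A] [AddSubgroupClass σ A]
  {𝒜 : ℕ → σ} [GradedRing 𝒜] {a : A} {m : ℕ} (ha : a ∈ 𝒜 m) (hm : 0 < m)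

lemma awayToSection_comp_appLE (h : ⊤ ≤ Proj.awayι 𝒜 a ha hm ⁻¹ᵁ Proj.basicOpen 𝒜 a) :
    Proj.awayToSection 𝒜 a ≫ (Proj.awayι 𝒜 a ha hm).appLE (Proj.basicOpen 𝒜 a) ⊤ h =
      (Scheme.ΓSpecIso _).inv := by
  let e := Proj.basicOpenIsoSpec 𝒜 a ha hm
  have h₁ : e.hom.appTop = _ := Proj.basicOpenToSpec_app_top 𝒜 a
  have h₂ : e.hom.appTop ≫ e.inv.appTop = 𝟙 _ := by
    rw [← Scheme.Hom.comp_appTop, e.inv_hom_id, Scheme.Hom.id_appTop]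
  have h₃ : (Proj.basicOpen 𝒜 a).topIso.inv ≫ e.inv.appTop =
      (Proj.awayι 𝒜 a ha hm).appLE (Proj.basicOpen 𝒜 a) ⊤ h := by
    change _ = (e.inv ≫ (Proj.basicOpen 𝒜 a).ι).appLE _ _ _
    rw [← Scheme.Hom.appLE_comp_appLE e.inv (Proj.basicOpen 𝒜 a).ι _ ⊤ _
      (by rw [Scheme.Opens.ι_preimage_self]) le_top, Scheme.Opens.ι_appLE]
    congr 1
  rw [h₁] at h₂
  rw [← h₃]
  exact (Iso.hom_comp_eq_id _).mp (by simpa only [Category.assoc] using h₂)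

/-- The function on `Spec T` obtained from a fraction of degree zero along a morphism to `Proj` that
factors through the affine open set where the denominator does not vanish. -/
lemma awayToSection_comp_appLE_SpecMap {T : CommRingCat.{u}}
    (χ : CommRingCat.of (HomogeneousLocalization.Away 𝒜 a) ⟶ T) {q : Spec T ⟶ Proj 𝒜}
    (hq : Spec.map χ ≫ Proj.awayι 𝒜 a ha hm = q) (hU : ⊤ ≤ q ⁻¹ᵁ Proj.basicOpen 𝒜 a) :
    Proj.awayToSection 𝒜 a ≫ q.appLE (Proj.basicOpen 𝒜 a) ⊤ hU ≫ (Scheme.ΓSpecIso T).hom = χ := by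
  subst hq
  have h₀ : ⊤ ≤ Proj.awayι 𝒜 a ha hm ⁻¹ᵁ Proj.basicOpen 𝒜 a := by
    intro x _
    change _ ∈ Proj.basicOpen _ _
    rw [← Proj.opensRange_awayι 𝒜 _ ha hm]
    exact ⟨x, rfl⟩
  have h₁ : (Spec.map χ ≫ Proj.awayι 𝒜 a ha hm).appLE (Proj.basicOpen 𝒜 a) ⊤ hU =
      (Proj.awayι 𝒜 a ha hm).appLE (Proj.basicOpen 𝒜 a) ⊤ h₀ ≫ (Spec.map χ).appTop := by
    rw [← Scheme.Hom.appLE_comp_appLE _ _ _ ⊤ _ h₀ le_top]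
    congr 1
  rw [h₁, Category.assoc, Scheme.ΓSpecIso_naturality, ← Category.assoc,
    awayToSection_comp_appLE, Iso.inv_hom_id_assoc]

end ProjPoint

section ProjectiveLine

attribute [local instance] MvPolynomial.gradedAlgebra

namespace P1

/-- The coordinate `uⱼ` on the chart `uᵢ = 1` of the projective line, as a polynomial in the other
coordinate. -/
def coord (i j : Fin 2) : Polynomial ℚ := if j = i then 1 else Polynomial.X

@[simp] lemma coord_self (i : Fin 2) : coord i i = 1 := if_pos rfl

lemma coord_of_ne {i j : Fin 2} (h : j ≠ i) : coord i j = Polynomial.X := if_neg h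

/-- The substitution `uᵢ = 1` in a polynomial in `u₀, u₁`. -/
def dehomogenize (i : Fin 2) : MvPolynomial (Fin 2) ℚ →ₐ[ℚ] Polynomial ℚ := aeval (coord i)

@[simp] lemma dehomogenize_X (i j : Fin 2) : dehomogenize i (X j) = coord i j := aeval_X _ _

@[simp] lemma dehomogenize_C (i : Fin 2) (c : ℚ) : dehomogenize i (C c) = Polynomial.C c :=
  algHom_C _ c

lemma X_mem (i : Fin 2) : (X i : MvPolynomial (Fin 2) ℚ) ∈ homogeneousSubmodule (Fin 2) ℚ 1 :=
  isHomogeneous_X ℚ i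

/-- The ring of functions on the standard open set `uᵢ ≠ 0`. -/
abbrev AwayRing (i : Fin 2) : Type :=
  HomogeneousLocalization.Away (homogeneousSubmodule (Fin 2) ℚ) (X i)

/-- The ring in which the functions on `uᵢ ≠ 0` are the elements of degree zero. -/
abbrev AwayLoc (i : Fin 2) : Type := Localization.Away (X i : MvPolynomial (Fin 2) ℚ)

/-- The fraction `uⱼ / uᵢ`. -/
def fraction (i j : Fin 2) : AwayRing i := HomogeneousLocalization.Away.mk
  (homogeneousSubmodule (Fin 2) ℚ) (X_mem i) 1 (X j) (by simpa using X_mem j)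

/-- The constant functions. -/
def constants (i : Fin 2) : ℚ →+* AwayRing i :=
  (HomogeneousLocalization.fromZeroRingHom (homogeneousSubmodule (Fin 2) ℚ) _).comp
    (algebraMap ℚ (homogeneousSubmodule (Fin 2) ℚ 0))

lemma val_fraction (i j : Fin 2) :
    algebraMap (MvPolynomial (Fin 2) ℚ) (AwayLoc i) (X i) * (fraction i j).val =
      algebraMap (MvPolynomial (Fin 2) ℚ) (AwayLoc i) (X j) := by
  rw [fraction, HomogeneousLocalization.Away.val_mk, ← Localization.mk_one_eq_algebraMap,
    ← Localization.mk_one_eq_algebraMap, Localization.mk_mul, Localization.mk_eq_mk_iff,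
    Localization.r_iff_exists]
  exact ⟨1, by simp⟩

/-- The homomorphism `uⱼ / uᵢ ↦ uⱼ` to the polynomial ring in one variable. -/
def awayToPolynomial (i : Fin 2) : AwayRing i →+* Polynomial ℚ :=
  (IsLocalization.Away.lift (S := AwayLoc i) (X i)
    (g := (dehomogenize i).toRingHom) (by simp)).comp
  (algebraMap (AwayRing i) (AwayLoc i))

lemma awayToPolynomial_mk (i : Fin 2) (n : ℕ) (p : MvPolynomial (Fin 2) ℚ)
    (hp : p ∈ homogeneousSubmodule (Fin 2) ℚ (n • 1)) :
    awayToPolynomial i (HomogeneousLocalization.Away.mk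
      (homogeneousSubmodule (Fin 2) ℚ) (X_mem i) n p hp) = dehomogenize i p := by
  rw [awayToPolynomial, RingHom.comp_apply, HomogeneousLocalization.algebraMap_apply,
    HomogeneousLocalization.Away.val_mk, Localization.mk_eq_mk', IsLocalization.Away.lift,
    IsLocalization.lift_mk'_spec]
  simp

/-- The homomorphism that sends the coordinate to `uⱼ / uᵢ`, for `j ≠ i`. -/
def polynomialToAway (i : Fin 2) : Polynomial ℚ →+* AwayRing i :=
  Polynomial.eval₂RingHom (constants i) (fraction i (1 - i))

lemma polynomialToAway_coord (i j : Fin 2) : polynomialToAway i (coord i j) = fraction i j := by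
  rcases eq_or_ne j i with rfl | h
  · rw [coord_self, map_one]
    apply HomogeneousLocalization.val_injective
    have hu := IsLocalization.Away.algebraMap_isUnit (S := AwayLoc j)
      (X j : MvPolynomial (Fin 2) ℚ)
    refine hu.mul_left_cancel ?_
    rw [val_fraction, HomogeneousLocalization.val_one, mul_one]
  · rw [coord_of_ne h, polynomialToAway, Polynomial.coe_eval₂RingHom, Polynomial.eval₂_X]
    congr 1
    omega

lemma val_polynomialToAway (i : Fin 2) {n : ℕ}
    {p : MvPolynomial (Fin 2) ℚ} (hp : p.IsHomogeneous n) :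
    algebraMap (MvPolynomial (Fin 2) ℚ) (AwayLoc i) (X i ^ n) *
      (polynomialToAway i (dehomogenize i p)).val =
      algebraMap (MvPolynomial (Fin 2) ℚ) (AwayLoc i) p := by
  let θ : MvPolynomial (Fin 2) ℚ →+* AwayLoc i := (algebraMap (AwayRing i) (AwayLoc i)).comp
    ((polynomialToAway i).comp (dehomogenize i).toRingHom)
  have hθ (j) : algebraMap (MvPolynomial (Fin 2) ℚ) (AwayLoc i) (X i) * θ (X j) =
      algebraMap (MvPolynomial (Fin 2) ℚ) (AwayLoc i) (X j) := by
    rw [← val_fraction i j, ← polynomialToAway_coord, ← dehomogenize_X]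
    rfl
  change _ * θ p = _
  have e (η : MvPolynomial (Fin 2) ℚ →+* AwayLoc i) :
      η p = ∑ d ∈ p.support, algebraMap ℚ _ (p.coeff d) * ∏ j, η (X j) ^ d j := by
    refine (congrArg η p.as_sum).trans ((map_sum _ _ _).trans ?_)
    refine Finset.sum_congr rfl fun d _ ↦ ?_
    rw [monomial_eq, map_mul, Finsupp.prod_fintype _ _ (fun _ ↦ pow_zero _), map_prod]
    simp only [map_pow]
    congr 1
    exact DFunLike.congr_fun (Subsingleton.elim (η.comp C) (algebraMap ℚ (AwayLoc i))) (p.coeff d)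
  rw [e θ, e (algebraMap (MvPolynomial (Fin 2) ℚ) (AwayLoc i)), Finset.mul_sum]
  refine Finset.sum_congr rfl fun d hd ↦ ?_
  have hn : n = ∑ i, d i := by
    rw [hp.degree_eq_sum_deg_support hd]
    exact Finset.sum_subset (Finset.subset_univ _) fun i _ hi ↦ by simpa using hi
  rw [← Finset.prod_congr rfl fun j _ ↦ congrArg (· ^ d j) (hθ j)]
  simp only [mul_pow, Finset.prod_mul_distrib]
  rw [Finset.prod_pow_eq_pow_sum, ← hn, map_pow]
  ring

lemma awayToPolynomial_comp (i : Fin 2) :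
    (awayToPolynomial i).comp (polynomialToAway i) = RingHom.id _ := by
  refine Polynomial.ringHom_ext' (Subsingleton.elim _ _) ?_
  have h : coord i (1 - i) = Polynomial.X := coord_of_ne (by fin_cases i <;> decide)
  rw [RingHom.id_apply, RingHom.comp_apply, ← h, polynomialToAway_coord, fraction,
    awayToPolynomial_mk, dehomogenize_X]

lemma polynomialToAway_comp (i : Fin 2) :
    (polynomialToAway i).comp (awayToPolynomial i) = RingHom.id _ := by
  refine RingHom.ext fun z ↦ ?_
  obtain ⟨n, p, hp, rfl⟩ := HomogeneousLocalization.Away.mk_surjective _ (X_mem i) z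
  rw [RingHom.comp_apply, awayToPolynomial_mk]
  apply HomogeneousLocalization.val_injective
  rw [RingHom.id_apply, HomogeneousLocalization.Away.val_mk, Localization.mk_eq_mk', eq_comm,
    IsLocalization.mk'_eq_iff_eq_mul, mul_comm]
  exact (val_polynomialToAway i (by simpa using hp)).symm

/-- The standard open set `uᵢ ≠ 0` is an affine line. -/
def awayEquiv (i : Fin 2) : AwayRing i ≃+* Polynomial ℚ :=
  RingEquiv.ofRingHom (awayToPolynomial i) (polynomialToAway i)
    (awayToPolynomial_comp i) (polynomialToAway_comp i)

/-- The chart `uᵢ ≠ 0` of the projective line as an open immersion of the affine line. -/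
def chartMap (i : Fin 2) : Spec (.of (Polynomial ℚ)) ⟶ P1 :=
  Spec.map (awayEquiv i).toCommRingCatIso.hom ≫
    Proj.awayι (homogeneousSubmodule (Fin 2) ℚ) (X i) (X_mem i) one_pos

instance (i : Fin 2) : IsOpenImmersion (chartMap i) :=
  inferInstanceAs (IsOpenImmersion (_ ≫ _))

lemma opensRange_chartMap (i : Fin 2) : (chartMap i).opensRange = nonvanishing i :=
  (Scheme.Hom.opensRange_comp_of_isIso _ _).trans
    (Proj.opensRange_awayι (homogeneousSubmodule (Fin 2) ℚ) _ (X_mem i) one_pos)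

lemma chartMap_toSpec (i : Fin 2) :
    chartMap i ≫ toSpec = Spec.map (CommRingCat.ofHom (algebraMap ℚ (Polynomial ℚ))) := by
  rw [chartMap, toSpec, Category.assoc, Proj.awayι_toSpecZero_assoc, ← Spec.map_comp,
    ← Spec.map_comp]
  congr 1
  refine CommRingCat.hom_ext ?_
  exact Subsingleton.elim (α := ℚ →+* Polynomial ℚ) _ _

/-- A form vanishes at a point of the chart `uᵢ ≠ 0` if its dehomogenisation does. -/
lemma mem_ideal_chartMap (i : Fin 2) {n : ℕ} {p : MvPolynomial (Fin 2) ℚ} (hn : 0 < n)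
    (hp : p.IsHomogeneous n) (z : Spec (.of (Polynomial ℚ))) :
    p ∈ ProjPoint.ideal (chartMap i z) ↔ dehomogenize i p ∈ z.asIdeal := by
  have hp' : p ∈ homogeneousSubmodule (Fin 2) ℚ n := hp
  have h₁ := SetLike.ext_iff.mp (Proj.awayι_preimage_basicOpen (homogeneousSubmodule (Fin 2) ℚ)
    (X_mem i) one_pos hp' hn) (Spec.map (awayEquiv i).toCommRingCatIso.hom z)
  refine not_iff_not.mp (h₁.trans (not_congr ?_))
  change awayToPolynomial i (HomogeneousLocalization.Away.mk _ (X_mem i) _ _ _) ∈ z.asIdeal ↔ _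
  rw [awayToPolynomial_mk, pow_one]

/-- On a morphism that factors through a chart, the function `uⱼ / uᵢ` is the coordinate. -/
lemma ratioOn_chartMap (i j : Fin 2) {T : CommRingCat.{0}} (ψ : Polynomial ℚ →+* T)
    {q : Spec T ⟶ P1} (hq : Spec.map (CommRingCat.ofHom ψ) ≫ chartMap i = q)
    (hU : ⊤ ≤ q ⁻¹ᵁ nonvanishing i) :
    (Scheme.ΓSpecIso T).hom (ratioOn q ⊤ i hU j) = ψ (coord i j) := by
  have h₁ := ProjPoint.awayToSection_comp_appLE_SpecMap (𝒜 := homogeneousSubmodule (Fin 2) ℚ)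
    (X_mem i) one_pos ((awayEquiv i).toCommRingCatIso.hom ≫ CommRingCat.ofHom ψ) (q := q)
    (by rw [← hq, Spec.map_comp, Category.assoc]; rfl) hU
  refine (DFunLike.congr_fun (congrArg CommRingCat.Hom.hom h₁) (fraction i j)).trans ?_
  change ψ (awayToPolynomial i (fraction i j)) = _
  rw [fraction, awayToPolynomial_mk, dehomogenize_X]

end P1

end ProjectiveLine

/-! ### Zeros of binary forms on the projective line -/

section Zeros

attribute [local instance] MvPolynomial.gradedAlgebra

namespace P1

/-- The zeros of a form on the projective line, as scheme points: conjugate geometric zeros form a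
single point. -/
def zeros (p : MvPolynomial (Fin 2) ℚ) : Set P1 := {y | p ∈ ProjPoint.ideal y}

lemma mem_nonvanishing_iff {i : Fin 2} {y : P1} : y ∈ nonvanishing i ↔ X i ∉ ProjPoint.ideal y :=
  Iff.rfl

lemma exists_X_notMem (y : P1) : ∃ i, X i ∉ ProjPoint.ideal y := by
  have : y ∈ ⨆ i, nonvanishing i := by rw [iSup_nonvanishing]; trivial
  simpa [mem_nonvanishing_iff] using this

lemma exists_chartMap_eq {i : Fin 2} {y : P1} (h : X i ∉ ProjPoint.ideal y) :
    ∃ z, chartMap i z = y := by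
  have : y ∈ (chartMap i).opensRange := by rw [opensRange_chartMap]; exact h
  exact this

/-- A form of which all zeros lie in one chart, and which is irreducible there, has exactly one
zero. -/
lemma exists_zeros_eq_singleton {p : MvPolynomial (Fin 2) ℚ} {n : ℕ} (hn : 0 < n)
    (hp : p.IsHomogeneous n) (i : Fin 2) (hi : ∀ y ∈ zeros p, X i ∉ ProjPoint.ideal y)
    (hirr : Irreducible (dehomogenize i p)) : ∃ y, zeros p = {y} := by
  have hmax : (Ideal.span {dehomogenize i p}).IsMaximal :=
    PrincipalIdealRing.isMaximal_of_irreducible hirr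
  refine ⟨chartMap i (⟨Ideal.span {dehomogenize i p}, hmax.isPrime⟩ : PrimeSpectrum _),
    Set.eq_singleton_iff_unique_mem.mpr ⟨?_, fun y hy ↦ ?_⟩⟩
  · exact (mem_ideal_chartMap i hn hp _).mpr (Ideal.mem_span_singleton_self _)
  · obtain ⟨z, rfl⟩ := exists_chartMap_eq (hi y hy)
    congr 1
    refine PrimeSpectrum.ext (hmax.eq_of_le z.isPrime.ne_top ?_).symm
    exact (Ideal.span_singleton_le_iff_mem _).mpr ((mem_ideal_chartMap i hn hp _).mp hy)

lemma X_notMem_of_X_mem {i j : Fin 2} (hij : i ≠ j) {y : P1} (h : X i ∈ ProjPoint.ideal y) :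
    X j ∉ ProjPoint.ideal y := by
  obtain ⟨k, hk⟩ := exists_X_notMem y
  obtain rfl | rfl : k = i ∨ k = j := by omega
  · exact absurd h hk
  · exact hk

lemma X_mem_of_C_mul_mem {i : Fin 2} {y : P1} {c : ℚ} (hc : c ≠ 0) {n : ℕ}
    (h : C c * X i ^ n ∈ ProjPoint.ideal y) : X i ∈ ProjPoint.ideal y := by
  have hunit : IsUnit (C c : MvPolynomial (Fin 2) ℚ) := (isUnit_iff_ne_zero.mpr hc).map C
  have h₁ : X i ^ n ∈ (ProjPoint.ideal y).toIdeal :=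
    ((ProjPoint.ideal y).toIdeal.unit_mul_mem_iff_mem hunit).mp h
  exact Ideal.IsPrime.mem_of_pow_mem inferInstance n h₁

lemma exists_zeros_linear_eq_singleton {α β : ℚ} (h : α ≠ 0 ∨ β ≠ 0) :
    ∃ y, zeros (C α * X 0 + C β * X 1) = {y} := by
  have hp : (C α * X 0 + C β * X 1 : MvPolynomial (Fin 2) ℚ).IsHomogeneous 1 :=
    .add ((isHomogeneous_C (Fin 2) α).mul (isHomogeneous_X ℚ 0))
      ((isHomogeneous_C (Fin 2) β).mul (isHomogeneous_X ℚ 1))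
  rcases eq_or_ne β 0 with rfl | hβ
  · have hα : α ≠ 0 := by simpa using h
    refine exists_zeros_eq_singleton one_pos hp 1 (fun y hy ↦ ?_) ?_
    · refine X_notMem_of_X_mem zero_ne_one (X_mem_of_C_mul_mem hα (n := 1) ?_)
      simpa [zeros] using hy
    · refine Polynomial.irreducible_of_degree_eq_one ?_
      simp [coord_of_ne, Polynomial.degree_C_mul_X hα]
  · refine exists_zeros_eq_singleton one_pos hp 0 (fun y hy h0 ↦ ?_) ?_
    · refine X_notMem_of_X_mem zero_ne_one h0 (X_mem_of_C_mul_mem hβ (n := 1) ?_)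
      have := (ProjPoint.ideal y).toIdeal.sub_mem hy
        ((ProjPoint.ideal y).toIdeal.mul_mem_left (C α) h0)
      simpa using! this
    · refine Polynomial.irreducible_of_degree_eq_one ?_
      simp only [map_add, map_mul, dehomogenize_C, dehomogenize_X, coord_self, mul_one,
        coord_of_ne one_ne_zero]
      rw [add_comm]
      exact Polynomial.degree_linear hβ

end P1

namespace BinaryQuadraticForm

variable (f : BinaryQuadraticForm)

/-- The form as a polynomial with rational coefficients. -/
abbrev form : MvPolynomial (Fin 2) ℚ := f.eval (X 0) (X 1)

lemma form_eq :
    f.form = C (f.a : ℚ) * X 0 ^ 2 + C (f.b : ℚ) * (X 0 * X 1) + C (f.c : ℚ) * X 1 ^ 2 := by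
  simp [form, eval]

lemma isHomogeneous_form : f.form.IsHomogeneous 2 := by
  rw [form_eq]
  refine .add (.add ?_ ?_) ?_
  · exact (isHomogeneous_C (Fin 2) _).mul ((isHomogeneous_X ℚ 0).pow 2)
  · exact (isHomogeneous_C (Fin 2) _).mul ((isHomogeneous_X ℚ 0).mul (isHomogeneous_X ℚ 1))
  · exact (isHomogeneous_C (Fin 2) _).mul ((isHomogeneous_X ℚ 1).pow 2)

/-- The two linear factors have different zeros, as the discriminant is the square of their
determinant. -/
lemma ncard_zeros_of_splits (hf : f.disc ≠ 0) (h : f.SplitsOverRat) :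
    (P1.zeros f.form).ncard = 2 := by
  obtain ⟨α, β, γ, δ, h⟩ := h
  have hev (x y : ℚ) : f.a * x ^ 2 + f.b * (x * y) + f.c * y ^ 2 =
      (α * x + β * y) * (γ * x + δ * y) := by
    have := congrArg (MvPolynomial.eval ![x, y]) h
    simpa [BinaryQuadraticForm.eval] using this
  have ha := hev 1 0
  have hc := hev 0 1
  have hb := hev 1 1
  have hdet : α * δ - β * γ ≠ 0 := by
    intro h0
    refine hf ?_
    have : (f.disc : ℚ) = (α * δ - β * γ) ^ 2 := by
      rw [disc]
      push_cast
      simp only [one_pow, mul_one, mul_zero, zero_pow two_ne_zero, add_zero, zero_add] at ha hb hc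
      have hb' : (f.b : ℚ) = α * δ + β * γ := by linear_combination hb - ha - hc
      rw [ha, hb', hc]
      ring
    rw [h0] at this
    exact_mod_cast this
  obtain ⟨y₁, h₁⟩ := P1.exists_zeros_linear_eq_singleton (α := α) (β := β) (by
    by_contra! h0
    simp [h0.1, h0.2] at hdet)
  obtain ⟨y₂, h₂⟩ := P1.exists_zeros_linear_eq_singleton (α := γ) (β := δ) (by
    by_contra! h0
    simp [h0.1, h0.2] at hdet)
  have hne : y₁ ≠ y₂ := by
    rintro rfl
    have m₁ : C α * X 0 + C β * X 1 ∈ (ProjPoint.ideal y₁).toIdeal := h₁.ge rfl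
    have m₂ : C γ * X 0 + C δ * X 1 ∈ (ProjPoint.ideal y₁).toIdeal := h₂.ge rfl
    refine P1.X_notMem_of_X_mem (y := y₁) zero_ne_one (P1.X_mem_of_C_mul_mem hdet (n := 1) ?_)
      (P1.X_mem_of_C_mul_mem hdet (n := 1) ?_)
    · have := Ideal.sub_mem _ (Ideal.mul_mem_left _ (C δ) m₁) (Ideal.mul_mem_left _ (C β) m₂)
      convert! this using 1
      simp only [map_sub, map_mul]
      ring
    · have := Ideal.sub_mem _ (Ideal.mul_mem_left _ (C α) m₂) (Ideal.mul_mem_left _ (C γ) m₁)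
      convert! this using 1
      simp only [map_sub, map_mul]
      ring
  have : P1.zeros f.form = {y₁, y₂} := by
    rw [Set.insert_eq, ← h₁, ← h₂, form, h]
    ext y
    exact Ideal.IsPrime.mul_mem_iff_mem_or_mem (I := (ProjPoint.ideal y).toIdeal) inferInstance
  rw [this, Set.ncard_pair hne]

/-- The zeros lie in the chart `u₀ = 1`, where the form is an irreducible quadratic polynomial. -/
lemma ncard_zeros_of_not_splits (h : ¬ f.SplitsOverRat) : (P1.zeros f.form).ncard = 1 := by
  have hc : (f.c : ℚ) ≠ 0 := fun hc ↦ h ⟨1, 0, f.a, f.b, by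
    refine f.form_eq.trans ?_
    rw [hc]
    simp
    ring⟩
  have hroot (r : ℚ) : f.a + f.b * r + f.c * r ^ 2 ≠ 0 := fun hr ↦ by
    refine h ⟨-r, 1, f.b + f.c * r, f.c, ?_⟩
    have ha : (f.a : ℚ) = - r * (f.b + f.c * r) := by linear_combination hr
    refine f.form_eq.trans ?_
    rw [ha]
    simp
    ring
  rw [Set.ncard_eq_one]
  refine P1.exists_zeros_eq_singleton two_pos f.isHomogeneous_form 0 (fun y hy h0 ↦ ?_) ?_
  · refine P1.X_notMem_of_X_mem zero_ne_one h0 (P1.X_mem_of_C_mul_mem hc (n := 2) ?_)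
    have := (ProjPoint.ideal y).toIdeal.sub_mem hy ((ProjPoint.ideal y).toIdeal.mul_mem_left
      (C (f.a : ℚ) * X 0 + C (f.b : ℚ) * X 1) h0)
    convert! this using 1
    rw [form_eq]
    ring
  · have e : P1.dehomogenize 0 f.form = Polynomial.C (f.c : ℚ) * Polynomial.X ^ 2 +
        Polynomial.C (f.b : ℚ) * Polynomial.X + Polynomial.C (f.a : ℚ) := by
      rw [form_eq]
      simp [P1.coord_of_ne]
      ring
    have hdeg := Polynomial.natDegree_quadratic hc (b := (f.b : ℚ)) (c := (f.a : ℚ))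
    rw [e, Polynomial.irreducible_iff_roots_eq_zero_of_degree_le_three hdeg.ge
      (by rw [hdeg]; simp)]
    refine Multiset.eq_zero_of_forall_notMem fun r hr ↦ hroot r ?_
    have := (Polynomial.mem_roots'.mp hr).2
    simp only [Polynomial.IsRoot, Polynomial.eval_add, Polynomial.eval_mul, Polynomial.eval_pow,
      Polynomial.eval_X, Polynomial.eval_C] at this
    linear_combination this

end BinaryQuadraticForm

end Zeros

/-! ### Primes of height one in the polynomial ring in two variables -/

section PolynomialAlgebra

variable {K : Type*} [Field K]

lemma separable_quadratic {p q r : K} (h : q ^ 2 - 4 * p * r ≠ 0) :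
    (Polynomial.C p * Polynomial.X ^ 2 + Polynomial.C q * Polynomial.X +
      Polynomial.C r).Separable := by
  -- `P'² - 4pP` is the discriminant of the quadratic polynomial `P`
  have hC : Polynomial.C (q ^ 2 - 4 * p * r)⁻¹ * Polynomial.C (q ^ 2 - 4 * p * r) = 1 := by
    rw [← Polynomial.C_mul, inv_mul_cancel₀ h, Polynomial.C_1]
  refine ⟨Polynomial.C (q ^ 2 - 4 * p * r)⁻¹ * Polynomial.C (-4 * p),
    Polynomial.C (q ^ 2 - 4 * p * r)⁻¹ *
      (2 * Polynomial.C p * Polynomial.X + Polynomial.C q), ?_⟩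
  have hd : (Polynomial.C p * Polynomial.X ^ 2 + Polynomial.C q * Polynomial.X +
      Polynomial.C r).derivative = 2 * Polynomial.C p * Polynomial.X + Polynomial.C q := by
    simp
    ring
  rw [hd]
  refine Eq.trans ?_ hC
  simp only [Polynomial.C_mul, Polynomial.C_sub, Polynomial.C_pow, Polynomial.C_neg,
    map_ofNat]
  ring

lemma not_isUnit_quadratic {p q r : K} (h : q ^ 2 - 4 * p * r ≠ 0) :
    ¬ IsUnit (Polynomial.C p * Polynomial.X ^ 2 + Polynomial.C q * Polynomial.X +
      Polynomial.C r) := by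
  refine Polynomial.not_isUnit_of_natDegree_pos _ ?_
  rcases eq_or_ne p 0 with rfl | hp
  · have hq : q ≠ 0 := by rintro rfl; simp at h
    simp [Polynomial.natDegree_linear hq]
  · simp [Polynomial.natDegree_quadratic hp]

/-- A squarefree polynomial of positive degree is not a square of a rational function. -/
lemma eq_zero_of_sq_mul_eq_sq {a b B : Polynomial K} (hB : Squarefree B) (hu : ¬ IsUnit B)
    (h : b ^ 2 * B = a ^ 2) : b = 0 := by
  by_contra hb
  obtain ⟨c, rfl⟩ : b ∣ a :=
      (UniqueFactorizationMonoid.pow_dvd_pow_iff_dvd two_ne_zero).mp ⟨B, h.symm⟩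
  have hc : B = c * c := by
    refine mul_left_cancel₀ (pow_ne_zero 2 hb) (h.trans ?_)
    ring
  have := hB c hc.symm.dvd
  exact hu (hc ▸ this.mul this)

lemma height_map_C_eq_one {z : Ideal (Polynomial K)} [hz : z.IsPrime] (h : z ≠ ⊥) :
    (z.map Polynomial.C).height = 1 := by
  have : z.IsMaximal := hz.isMaximal h
  rw [Polynomial.height_map_C]
  exact IsPrincipalIdealRing.height_eq_one_of_isMaximal _ (Polynomial.not_isField K)

/-- A prime of height one of `K[X][Y]` with non-trivial contraction to `K[X]` is the extension of
its contraction. -/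
lemma eq_map_C_of_height_eq_one {x : Ideal (Polynomial (Polynomial K))} [x.IsPrime]
    (hx : x.height = 1) (h : x.comap Polynomial.C ≠ ⊥) :
    x = (x.comap Polynomial.C).map Polynomial.C := by
  have : ((x.comap Polynomial.C).map Polynomial.C).IsPrime := Ideal.isPrime_map_C_of_isPrime
  refine (Ideal.eq_of_le_of_height_le _ Ideal.map_comap_le ?_).symm
  rw [hx, height_map_C_eq_one h]

end PolynomialAlgebra

namespace BinaryQuadraticForm

variable (f : BinaryQuadraticForm)

lemma dehomogenize_form (i : Fin 2) :
    P1.dehomogenize i f.form = f.eval (P1.coord i 0) (P1.coord i 1) :=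
  (f.map_eval (P1.dehomogenize i).toRingHom _ _).trans
    (congrArg₂ f.eval (P1.dehomogenize_X i 0) (P1.dehomogenize_X i 1))

variable {f} in
lemma exists_dehomogenize_eq (hf : f.disc ≠ 0) (i : Fin 2) : ∃ p q r : ℚ, q ^ 2 - 4 * p * r ≠ 0 ∧
    P1.dehomogenize i f.form =
      Polynomial.C p * Polynomial.X ^ 2 + Polynomial.C q * Polynomial.X + Polynomial.C r := by
  have h : (f.b : ℚ) ^ 2 - 4 * f.a * f.c ≠ 0 := by exact_mod_cast hf
  rcases eq_or_ne i 0 with rfl | hi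
  · refine ⟨f.c, f.b, f.a, fun h0 ↦ h (by linear_combination h0), ?_⟩
    simp [form_eq, P1.coord_of_ne]
    ring
  · obtain rfl : i = 1 := by omega
    refine ⟨f.a, f.b, f.c, h, ?_⟩
    simp [form_eq, P1.coord_of_ne]

variable {f} in
lemma dehomogenize_ne_zero (hf : f.disc ≠ 0) (i : Fin 2) : P1.dehomogenize i f.form ≠ 0 := by
  obtain ⟨p, q, r, h, e⟩ := exists_dehomogenize_eq hf i
  rw [e]
  exact (separable_quadratic h).ne_zero

variable {f} in
/-- A binary quadratic form of non-zero discriminant is not a square in the function field of the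
projective line over the number field `ℚ[s]/𝔷`; this function field is the residue field of the
prime of `ℚ[s][t]` that `𝔷` generates. -/
lemma not_isSquare_of_ker_eq (hf : f.disc ≠ 0) (i : Fin 2)
    {z : Ideal (Polynomial ℚ)} [hz : z.IsPrime] (hz0 : z ≠ ⊥) {F : Type*} [Field F]
    {ψ : Polynomial (Polynomial ℚ) →+* F}
    (hker : RingHom.ker ψ = z.map Polynomial.C) (hfrac : ∀ t, ∃ a b, ψ b ≠ 0 ∧ t = ψ a / ψ b) :
    ¬ IsSquare (ψ ((P1.dehomogenize i f.form).map (algebraMap ℚ (Polynomial ℚ)))) := by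
  rintro ⟨t, ht⟩
  obtain ⟨a, b, hb, rfl⟩ := hfrac t
  have : z.IsMaximal := hz.isMaximal hz0
  let _ := Ideal.Quotient.field z
  set B := (P1.dehomogenize i f.form).map (algebraMap ℚ (Polynomial ℚ)) with hB
  let ρ := Polynomial.mapRingHom (Ideal.Quotient.mk z)
  have hρ : RingHom.ker ρ = RingHom.ker ψ := by
    rw [hker, Polynomial.ker_mapRingHom, Ideal.mk_ker]
  have e : b ^ 2 * B - a ^ 2 ∈ RingHom.ker ρ := by
    rw [hρ, RingHom.mem_ker, map_sub, map_mul, ht, map_pow, map_pow]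
    field_simp
    ring
  rw [RingHom.mem_ker, map_sub, map_mul, map_pow, map_pow, sub_eq_zero] at e
  obtain ⟨p, q, r, h, e'⟩ := exists_dehomogenize_eq hf i
  have hρB : ρ B = (P1.dehomogenize i f.form).map
      ((Ideal.Quotient.mk z).comp (algebraMap ℚ (Polynomial ℚ))) := Polynomial.map_map _ _ _
  refine hb ?_
  rw [← RingHom.mem_ker, ← hρ]
  refine eq_zero_of_sq_mul_eq_sq (Polynomial.Separable.squarefree ?_) (fun hu ↦ ?_) e
  · rw [hρB, e']
    exact (separable_quadratic h).map
  · rw [hρB, Polynomial.isUnit_map] at hu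
    exact not_isUnit_quadratic h (e' ▸ hu)

end BinaryQuadraticForm

/-! ### Residue fields at the points of a product of two projective lines -/

section Product

lemma SpecMap_fromSpecStalk_appLE {W : Scheme.{0}} {U : W.Opens} {D : W} (hD : D ∈ U)
    {T : CommRingCat.{0}} (χ : W.presheaf.stalk D ⟶ T)
    (h : ⊤ ≤ (Spec.map χ ≫ W.fromSpecStalk D) ⁻¹ᵁ U) :
    (Spec.map χ ≫ W.fromSpecStalk D).appLE U ⊤ h ≫ (Scheme.ΓSpecIso T).hom =
      W.presheaf.germ U D hD ≫ χ := by
  have := Scheme.ΓSpecIso_naturality χ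
  rw [Scheme.Hom.appTop, Scheme.Hom.app_eq_appLE] at this
  rw [Scheme.Hom.appLE, Scheme.Hom.comp_app, Scheme.fromSpecStalk_app hD, Scheme.Hom.app_eq_appLE]
  simp only [Category.assoc]
  exact congrArg (W.presheaf.germ U D hD ≫ ·) ((Iso.inv_comp_eq _).mpr this)

/-- The value of a function at a point, as its pullback to the spectrum of the residue field. -/
lemma evaluation_eq_appLE {W : Scheme.{0}} (U : W.Opens) (D : W) (hD : D ∈ U)
    (h : ⊤ ≤ W.fromSpecResidueField D ⁻¹ᵁ U) :
    (W.fromSpecResidueField D).appLE U ⊤ h ≫ (Scheme.ΓSpecIso _).hom = W.evaluation U D hD :=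
  SpecMap_fromSpecStalk_appLE hD (W.residue D) h

lemma exists_algebraMap_div_algebraMap_eq {A : Type*} [CommRing A] (I : Ideal A) [I.IsPrime]
    (t : I.ResidueField) : ∃ a b, algebraMap A I.ResidueField b ≠ 0 ∧
      t = algebraMap A I.ResidueField a / algebraMap A I.ResidueField b := by
  obtain ⟨a, b, hb, rfl⟩ := IsFractionRing.div_surjective (A := A ⧸ I) t
  obtain ⟨a, rfl⟩ := Ideal.Quotient.mk_surjective a
  obtain ⟨b, rfl⟩ := Ideal.Quotient.mk_surjective b
  exact ⟨a, b, IsFractionRing.to_map_ne_zero_of_mem_nonZeroDivisors (R := A ⧸ I) hb, rfl⟩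

/-- A point in an affine chart, as a homomorphism of the coordinate ring to its residue field. -/
lemma exists_hom_residueField {A : CommRingCat.{0}} {W : Scheme.{0}} (E : Spec A ⟶ W)
    [IsOpenImmersion E] (x : Spec A) : ∃ ψ : A →+* W.residueField (E x),
      Spec.map (CommRingCat.ofHom ψ) ≫ E = W.fromSpecResidueField (E x) ∧
      RingHom.ker ψ = x.asIdeal ∧ ∀ t, ∃ a b, ψ b ≠ 0 ∧ t = ψ a / ψ b := by
  have : x.asIdeal.IsPrime := x.isPrime
  let e : CommRingCat.of x.asIdeal.ResidueField ≅ W.residueField (E x) :=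
    (Scheme.Spec.residueFieldIso A x).symm ≪≫ (asIso (E.residueFieldMap x)).symm
  let e' : x.asIdeal.ResidueField ≃+* W.residueField (E x) := e.commRingCatIsoToRingEquiv
  refine ⟨e'.toRingHom.comp (algebraMap A x.asIdeal.ResidueField), ?_, ?_, fun t ↦ ?_⟩
  · have h₁ : CommRingCat.ofHom (e'.toRingHom.comp (algebraMap A x.asIdeal.ResidueField)) =
      CommRingCat.ofHom (algebraMap A x.asIdeal.ResidueField) ≫
        (Scheme.Spec.residueFieldIso A x).inv ≫ inv (E.residueFieldMap x) := rfl
    rw [h₁, Spec.map_comp, Spec.map_comp, Category.assoc, Category.assoc]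
    rw [Scheme.Spec.map_residueFieldIso_inv_eq_fromSpecResidueField_assoc,
      ← E.SpecMap_residueFieldMap_fromSpecResidueField, ← Spec.map_comp_assoc,
      IsIso.hom_inv_id, Spec.map_id]
    exact Category.id_comp _
  · exact (RingHom.ker_comp_of_injective _ e'.injective).trans
      (Ideal.ker_algebraMap_residueField _)
  · obtain ⟨a, b, hb, h⟩ := exists_algebraMap_div_algebraMap_eq x.asIdeal (e'.symm t)
    refine ⟨a, b, (map_ne_zero_iff e' e'.injective).mpr hb, ?_⟩
    rw [← e'.apply_symm_apply t, h]
    exact map_div₀ e'.toRingHom _ _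

attribute [local instance] Polynomial.algebra in
lemma isPullback_polynomial (S : Type) [CommRing S] [Algebra ℚ S] : IsPullback
    (Spec.map (CommRingCat.ofHom (Polynomial.C : S →+* Polynomial S)))
    (Spec.map (CommRingCat.ofHom (Polynomial.mapRingHom (algebraMap ℚ S))))
    (Spec.map (CommRingCat.ofHom (algebraMap ℚ S)))
    (Spec.map (CommRingCat.ofHom (algebraMap ℚ (Polynomial ℚ)))) :=
  isPullback_SpecMap_of_isPushout _ _ _ _
    (CommRingCat.isPushout_of_isPushout ℚ S (Polynomial ℚ) (Polynomial S))

attribute [local instance] MvPolynomial.gradedAlgebra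

variable {W : Scheme.{0}} {p q : W ⟶ P1}

/-- The standard charts of a product of two projective lines. The product is given by a pullback
square, in order that the two factors can be interchanged. -/
lemma exists_chart (h : IsPullback p q P1.toSpec P1.toSpec) (i j : Fin 2) :
    ∃ E : Spec (.of (Polynomial (Polynomial ℚ))) ⟶ W, IsOpenImmersion E ∧
      E ≫ p = Spec.map (CommRingCat.ofHom Polynomial.C) ≫ P1.chartMap i ∧
      E ≫ q = Spec.map (CommRingCat.ofHom (Polynomial.mapRingHom (algebraMap ℚ (Polynomial ℚ)))) ≫
        P1.chartMap j ∧
      ∀ D, X i ∉ ProjPoint.ideal (p D) → X j ∉ ProjPoint.ideal (q D) → D ∈ Set.range E := by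
  let ιℚ := Spec.map (CommRingCat.ofHom (algebraMap ℚ (Polynomial ℚ)))
  have h₀ : IsPullback _ _ ιℚ ιℚ := isPullback_polynomial (Polynomial ℚ)
  let m := pullback.map ιℚ ιℚ P1.toSpec P1.toSpec (P1.chartMap i) (P1.chartMap j) (𝟙 _)
    ((Category.comp_id _).trans (P1.chartMap_toSpec i).symm)
    ((Category.comp_id _).trans (P1.chartMap_toSpec j).symm)
  refine ⟨h₀.isoPullback.hom ≫ m ≫ h.isoPullback.inv, inferInstance, ?_, ?_, fun D hi hj ↦ ?_⟩
  · simp only [Category.assoc, IsPullback.isoPullback_inv_fst, m, pullback.map,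
      pullback.lift_fst, IsPullback.isoPullback_hom_fst_assoc]
  · simp only [Category.assoc, IsPullback.isoPullback_inv_snd, m, pullback.map,
      pullback.lift_snd, IsPullback.isoPullback_hom_snd_assoc]
  · obtain ⟨z₁, hz₁⟩ := P1.exists_chartMap_eq hi
    obtain ⟨z₂, hz₂⟩ := P1.exists_chartMap_eq hj
    have : h.isoPullback.hom D ∈ Set.range m := by
      rw [Scheme.Pullback.range_map]
      refine ⟨⟨z₁, hz₁.trans ?_⟩, ⟨z₂, hz₂.trans ?_⟩⟩
      · rw [← Scheme.Hom.comp_apply, IsPullback.isoPullback_hom_fst]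
      · rw [← Scheme.Hom.comp_apply, IsPullback.isoPullback_hom_snd]
    obtain ⟨t, ht⟩ := this
    refine ⟨h₀.isoPullback.inv t, ?_⟩
    rw [← Scheme.Hom.comp_apply, Iso.inv_hom_id_assoc, Scheme.Hom.comp_apply, ht,
      ← Scheme.Hom.comp_apply, Iso.hom_inv_id]
    rfl

end Product

/-! ### The codimension one points above the zeros of a form on a factor -/

section CodimOne

attribute [local instance] MvPolynomial.gradedAlgebra

variable {W : Scheme.{0}}

/-- The value of a form at a point, in terms of a coordinate of the point with values in its residue
field. -/
lemma evaluation_form_eq (f : BinaryQuadraticForm) {r : W ⟶ P1} {U : W.Opens} {i : Fin 2}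
    (hU : U ≤ r ⁻¹ᵁ P1.nonvanishing i) {D : W} (hD : D ∈ U)
    {χ : Polynomial ℚ →+* W.residueField D}
    (hχ : Spec.map (CommRingCat.ofHom χ) ≫ P1.chartMap i = W.fromSpecResidueField D ≫ r) :
    W.evaluation U D hD (f.eval (P1.ratioOn r U i hU 0) (P1.ratioOn r U i hU 1)) =
      χ (P1.dehomogenize i f.form) := by
  have h : ⊤ ≤ W.fromSpecResidueField D ⁻¹ᵁ U := fun s _ ↦ by
    change W.fromSpecResidueField D s ∈ U
    rwa [Scheme.fromSpecResidueField_apply]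
  have hratio (j : Fin 2) : W.evaluation U D hD (P1.ratioOn r U i hU j) = χ (P1.coord i j) := by
    have hU' : ⊤ ≤ (W.fromSpecResidueField D ≫ r) ⁻¹ᵁ P1.nonvanishing i := fun s hs ↦ hU (h hs)
    rw [← P1.ratioOn_chartMap i j χ hχ hU', ← evaluation_eq_appLE U D hD h, CommRingCat.comp_apply]
    congr 1
    rw [P1.ratioOn, P1.ratioOn, ← CommRingCat.comp_apply, Scheme.Hom.appLE_comp_appLE]
  rw [BinaryQuadraticForm.dehomogenize_form]
  refine (f.map_eval (W.evaluation U D hD).hom _ _).trans (Eq.trans ?_ (f.map_eval χ _ _).symm)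
  exact congrArg₂ f.eval (hratio 0) (hratio 1)

lemma evaluation_form_eq_zero_iff (f : BinaryQuadraticForm) {r : W ⟶ P1} {U : W.Opens} {i : Fin 2}
    (hU : U ≤ r ⁻¹ᵁ P1.nonvanishing i) {D : W} (hD : D ∈ U) :
    W.evaluation U D hD (f.eval (P1.ratioOn r U i hU 0) (P1.ratioOn r U i hU 1)) = 0 ↔
      r D ∈ P1.zeros f.form := by
  have hrange : Set.range (W.fromSpecResidueField D ≫ r) ⊆ Set.range (P1.chartMap i) := by
    rintro _ ⟨s, rfl⟩
    rw [Scheme.Hom.comp_apply, Scheme.fromSpecResidueField_apply]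
    exact P1.exists_chartMap_eq (hU hD)
  let l := IsOpenImmersion.lift (P1.chartMap i) _ hrange
  have hl : Spec.map (CommRingCat.ofHom (Spec.preimage l).hom) ≫ P1.chartMap i =
      W.fromSpecResidueField D ≫ r := by
    rw [CommRingCat.ofHom_hom, Spec.map_preimage]
    exact IsOpenImmersion.lift_fac ..
  rw [evaluation_form_eq f hU hD hl]
  let s : Spec (W.residueField D) := (⊥ : PrimeSpectrum (W.residueField D))
  have hz : P1.chartMap i (Spec.map (CommRingCat.ofHom (Spec.preimage l).hom) s) = r D := by
    rw [← Scheme.Hom.comp_apply, hl, Scheme.Hom.comp_apply, Scheme.fromSpecResidueField_apply]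
  rw [← hz]
  exact (P1.mem_ideal_chartMap i two_pos f.isHomogeneous_form
    (Spec.map (CommRingCat.ofHom (Spec.preimage l).hom) s)).symm

/-- The points of codimension one at which a form on a factor vanishes. -/
def codimOneZeros (p : W ⟶ P1) (f : BinaryQuadraticForm) : Set W :=
  {D | D ∈ Fibration.codimOnePoints W ∧ p D ∈ P1.zeros f.form}

lemma C_mem_map_C_iff {A : Type*} [CommRing A] {z : Ideal A} {a : A} :
    Polynomial.C a ∈ z.map Polynomial.C ↔ a ∈ z := by
  refine ⟨fun h ↦ ?_, Ideal.mem_map_of_mem _⟩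
  simpa using Ideal.mem_map_C_iff.mp h 0

variable {f : BinaryQuadraticForm}

lemma ne_bot_of_mem_zeros (hf : f.disc ≠ 0) {i : Fin 2} {z : Spec (.of (Polynomial ℚ))}
    (h : P1.chartMap i z ∈ P1.zeros f.form) : z.asIdeal ≠ ⊥ := fun h0 ↦ by
  have := (P1.mem_ideal_chartMap i two_pos f.isHomogeneous_form z).mp h
  rw [h0] at this
  exact BinaryQuadraticForm.dehomogenize_ne_zero hf i this

variable {p q : W ⟶ P1}

/-- In a chart, a point of codimension one above a zero of a form is given by the extension of the
prime ideal of the zero. -/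
lemma asIdeal_eq_map_C (hf : f.disc ≠ 0) {i : Fin 2}
    {E : Spec (.of (Polynomial (Polynomial ℚ))) ⟶ W} [IsOpenImmersion E]
    (hE : E ≫ p = Spec.map (CommRingCat.ofHom Polynomial.C) ≫ P1.chartMap i)
    {x} (hx : E x ∈ codimOneZeros p f) : ∃ z : Spec (.of (Polynomial ℚ)),
      P1.chartMap i z = p (E x) ∧ z.asIdeal ≠ ⊥ ∧ x.asIdeal = z.asIdeal.map Polynomial.C := by
  let z := Spec.map (CommRingCat.ofHom (Polynomial.C (R := Polynomial ℚ))) x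
  have hz : P1.chartMap i z = p (E x) := by
    rw [← Scheme.Hom.comp_apply, ← Scheme.Hom.comp_apply, hE]
  have hz0 := ne_bot_of_mem_zeros hf (i := i) (z := z) (hz ▸ hx.2)
  have hh : x.asIdeal.height = 1 := by
    refine (idealHeight_eq_coheight _ x).trans ?_
    rw [← coheight_eq_of_isOpenImmersion E]
    exact hx.1
  have : x.asIdeal.IsPrime := x.isPrime
  exact ⟨z, hz, hz0, eq_map_C_of_height_eq_one hh hz0⟩
/-- A line above a point of the first factor dominates the second factor, so it meets every chart of
it. -/
lemma X_notMem_of_mem_codimOneZeros (hf : f.disc ≠ 0)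
    (h : IsPullback p q P1.toSpec P1.toSpec) {D : W} (hD : D ∈ codimOneZeros p f) (k : Fin 2) :
    X k ∉ ProjPoint.ideal (q D) := by
  obtain ⟨i, hi⟩ := P1.exists_X_notMem (p D)
  obtain ⟨j, hj⟩ := P1.exists_X_notMem (q D)
  obtain ⟨E, _, hp, hq, hE⟩ := exists_chart h i j
  obtain ⟨x, rfl⟩ := hE D hi hj
  obtain ⟨z, -, -, hx⟩ := asIdeal_eq_map_C hf hp hD
  rw [← Scheme.Hom.comp_apply, hq, Scheme.Hom.comp_apply,
    P1.mem_ideal_chartMap j one_pos (isHomogeneous_X ℚ k), P1.dehomogenize_X]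
  change Polynomial.map (algebraMap ℚ (Polynomial ℚ)) (P1.coord j k) ∉ x.asIdeal
  rw [hx]
  intro hmem
  refine z.isPrime.ne_top ((Ideal.eq_top_iff_one _).mpr ?_)
  rcases eq_or_ne k j with rfl | hkj
  · simpa using Ideal.mem_map_C_iff.mp hmem 0
  · rw [P1.coord_of_ne hkj] at hmem
    simpa using Ideal.mem_map_C_iff.mp hmem 1

/-- The points of codimension one at which a form on a factor vanishes are the lines above its
zeros. -/
lemma bijOn_codimOneZeros (hf : f.disc ≠ 0)
    (h : IsPullback p q P1.toSpec P1.toSpec) :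
    Set.BijOn p (codimOneZeros p f) (P1.zeros f.form) := by
  refine ⟨fun D hD ↦ hD.2, fun D hD D' hD' e ↦ ?_, fun y hy ↦ ?_⟩
  · obtain ⟨i, hi⟩ := P1.exists_X_notMem (p D)
    obtain ⟨E, _, hp, hq, hE⟩ := exists_chart h i 0
    obtain ⟨x, rfl⟩ := hE D hi (X_notMem_of_mem_codimOneZeros hf h hD 0)
    obtain ⟨x', rfl⟩ := hE D' (e ▸ hi) (X_notMem_of_mem_codimOneZeros hf h hD' 0)
    obtain ⟨z, hz, -, hx⟩ := asIdeal_eq_map_C hf hp hD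
    obtain ⟨z', hz', -, hx'⟩ := asIdeal_eq_map_C hf hp hD'
    obtain rfl : z = z' := (P1.chartMap i).isOpenEmbedding.injective (hz.trans (e.trans hz'.symm))
    congr 1
    exact PrimeSpectrum.ext (hx.trans hx'.symm)
  · obtain ⟨i, hi⟩ := P1.exists_X_notMem y
    obtain ⟨z, rfl⟩ := P1.exists_chartMap_eq hi
    obtain ⟨E, _, hp, hq, hE⟩ := exists_chart h i 0
    have hz := ne_bot_of_mem_zeros hf hy
    have hprime : z.asIdeal.IsPrime := z.isPrime
    let x : Spec (.of (Polynomial (Polynomial ℚ))) :=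
      (⟨z.asIdeal.map Polynomial.C, Ideal.isPrime_map_C_of_isPrime⟩ : PrimeSpectrum _)
    have hpx : p (E x) = P1.chartMap i z := by
      rw [← Scheme.Hom.comp_apply, hp, Scheme.Hom.comp_apply]
      congr 1
      exact PrimeSpectrum.ext (Ideal.ext fun a ↦ C_mem_map_C_iff)
    refine ⟨E x, ⟨?_, hpx ▸ hy⟩, hpx⟩
    refine (coheight_eq_of_isOpenImmersion E).trans ?_
    exact (idealHeight_eq_coheight _ x).symm.trans (height_map_C_eq_one hz)

/-- At a point of codimension one that lies above a zero of a form on one factor, a form on the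
other factor is not a square. -/
lemma not_isSquare_evaluation (hf : f.disc ≠ 0)
    (h : IsPullback p q P1.toSpec P1.toSpec) {g : BinaryQuadraticForm} (hg : g.disc ≠ 0) {D : W}
    (hD : D ∈ codimOneZeros p f) {U : W.Opens} {j : Fin 2} (hU : U ≤ q ⁻¹ᵁ P1.nonvanishing j)
    (hDU : D ∈ U) :
    ¬ IsSquare (W.evaluation U D hDU (g.eval (P1.ratioOn q U j hU 0) (P1.ratioOn q U j hU 1))) := by
  obtain ⟨i, hi⟩ := P1.exists_X_notMem (p D)
  obtain ⟨E, _, hp, hq, hE⟩ := exists_chart h i j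
  obtain ⟨x, rfl⟩ := hE D hi (hU hDU)
  obtain ⟨z, -, hz, hx⟩ := asIdeal_eq_map_C hf hp hD
  obtain ⟨ψ, hψ, hker, hfrac⟩ := exists_hom_residueField E x
  have : z.asIdeal.IsPrime := z.isPrime
  have := BinaryQuadraticForm.not_isSquare_of_ker_eq hg j hz (hker.trans hx) hfrac
  rwa [evaluation_form_eq g hU hDU
    (χ := ψ.comp (Polynomial.mapRingHom (algebraMap ℚ (Polynomial ℚ))))]
  rw [← hψ, Category.assoc, hq, ← Spec.map_comp_assoc]
  rfl

end CodimOne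

/-! ### The sum of the local contributions -/

section Sum

attribute [local instance] MvPolynomial.gradedAlgebra

lemma P1xP1.isPullback : IsPullback P1xP1.fst P1xP1.snd P1.toSpec P1.toSpec :=
  IsPullback.of_hasPullback _ _

lemma ncard_codimOneZeros {W : Scheme.{0}} {p q : W ⟶ P1} {f : BinaryQuadraticForm}
    (hf : f.disc ≠ 0) (h : IsPullback p q P1.toSpec P1.toSpec) :
    (codimOneZeros p f).ncard = (P1.zeros f.form).ncard := by
  have := bijOn_codimOneZeros hf h
  rw [← this.image_eq, this.injOn.ncard_image]

lemma BinaryQuadraticForm.finite_zeros {f : BinaryQuadraticForm} (hf : f.disc ≠ 0) :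
    (P1.zeros f.form).Finite := by
  refine Set.finite_of_ncard_ne_zero ?_
  by_cases h : f.SplitsOverRat
  · rw [f.ncard_zeros_of_splits hf h]
    exact two_ne_zero
  · rw [f.ncard_zeros_of_not_splits h]
    exact one_ne_zero

lemma finite_codimOneZeros {W : Scheme.{0}} {p q : W ⟶ P1} {f : BinaryQuadraticForm}
    (hf : f.disc ≠ 0) (h : IsPullback p q P1.toSpec P1.toSpec) : (codimOneZeros p f).Finite :=
  (bijOn_codimOneZeros hf h).finite_iff_finite.mpr (f.finite_zeros hf)

namespace conicBundle

variable {f g : BinaryQuadraticForm}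

lemma localDensity_of_mem_left (hf : f.disc ≠ 0) (hg : g.disc ≠ 0) {D : P1xP1}
    (hD : D ∈ codimOneZeros P1xP1.fst f) : Finite (Fibration.actingGroup (π f g) D) ∧
      Fibration.localDensity (π f g) D = 1 / 2 := by
  obtain ⟨P, hP, -⟩ := Patch.exists_le (show D ∈ (⊤ : P1xP1.Opens) from trivial)
  refine localDensity_of_not_isSquare f g P hP (k := 0) (m := 1) (by decide) (by decide)
    (by decide) ((evaluation_form_eq_zero_iff f P.le_fst hP).mpr hD.2) ?_
  exact not_isSquare_evaluation hf P1xP1.isPullback hg hD P.le_snd hP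

lemma localDensity_of_mem_right (hf : f.disc ≠ 0) (hg : g.disc ≠ 0) {D : P1xP1}
    (hD : D ∈ codimOneZeros P1xP1.snd g) : Finite (Fibration.actingGroup (π f g) D) ∧
      Fibration.localDensity (π f g) D = 1 / 2 := by
  obtain ⟨P, hP, -⟩ := Patch.exists_le (show D ∈ (⊤ : P1xP1.Opens) from trivial)
  refine localDensity_of_not_isSquare f g P hP (k := 1) (m := 0) (by decide) (by decide)
    (by decide) ((evaluation_form_eq_zero_iff g P.le_snd hP).mpr hD.2) ?_
  exact not_isSquare_evaluation hg P1xP1.isPullback.flip hf hD P.le_fst hP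

lemma localDensity_of_notMem {D : P1xP1} (hD : D ∈ Fibration.codimOnePoints P1xP1)
    (hDf : D ∉ codimOneZeros P1xP1.fst f) (hDg : D ∉ codimOneZeros P1xP1.snd g) :
    Finite (Fibration.actingGroup (π f g) D) ∧ Fibration.localDensity (π f g) D = 1 := by
  obtain ⟨P, hP, -⟩ := Patch.exists_le (show D ∈ (⊤ : P1xP1.Opens) from trivial)
  refine localDensity_of_smooth f g P hP fun i ↦ ?_
  fin_cases i
  · exact fun h0 ↦ hDf ⟨hD, (evaluation_form_eq_zero_iff f P.le_fst hP).mp h0⟩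
  · exact fun h0 ↦ hDg ⟨hD, (evaluation_form_eq_zero_iff g P.le_snd hP).mp h0⟩
  · change P1xP1.evaluation P.U D hP (-1) ≠ 0
    rw [map_neg, map_one]
    exact neg_ne_zero.mpr one_ne_zero

/-- The two families of singular fibres lie over different points. -/
lemma disjoint_codimOneZeros (hf : f.disc ≠ 0) (hg : g.disc ≠ 0) :
    Disjoint (codimOneZeros P1xP1.fst f) (codimOneZeros P1xP1.snd g) := by
  refine Set.disjoint_left.mpr fun D hDf hDg ↦ ?_
  obtain ⟨P, hP, -⟩ := Patch.exists_le (show D ∈ (⊤ : P1xP1.Opens) from trivial)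
  refine not_isSquare_evaluation hf P1xP1.isPullback hg hDf P.le_snd hP ?_
  rw [(evaluation_form_eq_zero_iff g P.le_snd hP).mpr hDg.2]
  exact IsSquare.zero

lemma finite_actingGroup (hf : f.disc ≠ 0) (hg : g.disc ≠ 0) {D : P1xP1}
    (hD : D ∈ Fibration.codimOnePoints P1xP1) : Finite (Fibration.actingGroup (π f g) D) := by
  by_cases hDf : D ∈ codimOneZeros P1xP1.fst f
  · exact (localDensity_of_mem_left hf hg hDf).1
  by_cases hDg : D ∈ codimOneZeros P1xP1.snd g
  · exact (localDensity_of_mem_right hf hg hDg).1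
  exact (localDensity_of_notMem hD hDf hDg).1

lemma localDensity_ne_one_subset : {D ∈ Fibration.codimOnePoints P1xP1 |
    Fibration.localDensity (π f g) D ≠ 1} ⊆
      codimOneZeros P1xP1.fst f ∪ codimOneZeros P1xP1.snd g := fun D hD ↦ by
  by_contra hn
  rw [Set.mem_union, not_or] at hn
  exact hD.2 (localDensity_of_notMem hD.1 hn.1 hn.2).2

lemma invariantDelta_eq (hf : f.disc ≠ 0) (hg : g.disc ≠ 0) : Fibration.invariantDelta (π f g) =
    ((P1.zeros f.form).ncard + (P1.zeros g.form).ncard) / 2 := by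
  have hF := finite_codimOneZeros hf P1xP1.isPullback
  have hG := finite_codimOneZeros hg P1xP1.isPullback.flip
  have hhalf {D : P1xP1} (hD : D ∈ codimOneZeros P1xP1.fst f ∪ codimOneZeros P1xP1.snd g) :
      1 - Fibration.localDensity (π f g) D = 1 / 2 := by
    rcases hD with hD | hD
    · rw [(localDensity_of_mem_left hf hg hD).2]
      norm_num
    · rw [(localDensity_of_mem_right hf hg hD).2]
      norm_num
  have hsub : codimOneZeros P1xP1.fst f ∪ codimOneZeros P1xP1.snd g ⊆
      Fibration.codimOnePoints P1xP1 := Set.union_subset (fun _ h ↦ h.1) fun _ h ↦ h.1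
  have hsupp : Fibration.codimOnePoints P1xP1 ∩
      Function.support (fun D ↦ 1 - Fibration.localDensity (π f g) D) ⊆
        ((hF.union hG).toFinset : Set P1xP1) := fun D hD ↦ by
    rw [Set.Finite.coe_toFinset]
    exact localDensity_ne_one_subset ⟨hD.1, fun h ↦ hD.2 (sub_eq_zero_of_eq h.symm)⟩
  rw [Fibration.invariantDelta,
    finsum_set_coe_eq_finsum_mem (f := fun D ↦ 1 - Fibration.localDensity (π f g) D),
    finsum_mem_eq_sum_of_subset _ hsupp (by rwa [Set.Finite.coe_toFinset]),
    Finset.sum_congr rfl fun D hD ↦ hhalf ((Set.Finite.mem_toFinset _).mp hD), Finset.sum_const,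
    ← Set.ncard_eq_toFinset_card _ (hF.union hG),
    Set.ncard_union_eq (disjoint_codimOneZeros hf hg) hF hG,
    ncard_codimOneZeros hf P1xP1.isPullback, ncard_codimOneZeros hg P1xP1.isPullback.flip]
  rw [nsmul_eq_mul, Nat.cast_add]
  ring

end conicBundle

end Sum

end

theorem proposition2p1 (f g : BinaryQuadraticForm) (hf : f.disc ≠ 0) (hg : g.disc ≠ 0) :
    (∀ D ∈ Fibration.codimOnePoints P1xP1,
      Finite (Fibration.actingGroup (conicBundle.π f g) D)) ∧
    {D ∈ Fibration.codimOnePoints P1xP1 |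
      Fibration.localDensity (conicBundle.π f g) D ≠ 1}.Finite ∧
    (f.SplitsOverRat ∧ g.SplitsOverRat →
      Fibration.invariantDelta (conicBundle.π f g) = 2) ∧
    (Xor f.SplitsOverRat g.SplitsOverRat →
      Fibration.invariantDelta (conicBundle.π f g) = 3 / 2) ∧
    (¬ f.SplitsOverRat ∧ ¬ g.SplitsOverRat →
      Fibration.invariantDelta (conicBundle.π f g) = 1) := by
  refine ⟨fun D hD ↦ conicBundle.finite_actingGroup hf hg hD,
    ((finite_codimOneZeros hf P1xP1.isPullback).union
      (finite_codimOneZeros hg P1xP1.isPullback.flip)).subset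
        conicBundle.localDensity_ne_one_subset, ?_, ?_, ?_⟩
  · rintro ⟨h, h'⟩
    rw [conicBundle.invariantDelta_eq hf hg, f.ncard_zeros_of_splits hf h,
      g.ncard_zeros_of_splits hg h']
    norm_num
  · rintro (⟨h, h'⟩ | ⟨h', h⟩)
    · rw [conicBundle.invariantDelta_eq hf hg, f.ncard_zeros_of_splits hf h,
        g.ncard_zeros_of_not_splits h']
      norm_num
    · rw [conicBundle.invariantDelta_eq hf hg, f.ncard_zeros_of_not_splits h,
        g.ncard_zeros_of_splits hg h']
      norm_num
  · rintro ⟨h, h'⟩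
    rw [conicBundle.invariantDelta_eq hf hg, f.ncard_zeros_of_not_splits h,
      g.ncard_zeros_of_not_splits h']
    norm_num
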